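/- Let $K$ be a totally real number field with ring of integers $R$, let $B$ be a quaternion algebra over $K$ that splits at exactly one infinite place, i.e. $B\otimes_{\mathbb Q}\mathbb R\simeq M(2,\mathbb R)\times\mathbb H^{[K:\mathbb Q]-1}$ with $\mathbb H$ Hamilton's quaternions, and assume $B\not\simeq M(2,\mathbb Q)$. Let $\iota:B\hookrightarrow M(2,\mathbb R)$ be an embedding, let $\mathcal O$ be an $R$-order of $B$, and let $\Gamma(\mathcal O)\subset SL(2,\mathbb R)$ be the image under $\iota$ of the group of elements of reduced norm $1$ of $\mathcal O$. Let $\Gamma$ be a discrete subgroup of $SL(2,\mathbb R)$ commensurable with $\Gamma(\mathcal O)$, and let $X=\Gamma\backslash\mathfrak H$ be the associated Shimura curve, where $\mathfrak H$ is the upper half-plane. Assume that the compact Riemann surface $X$ has genus zero. Let $\tau_1,\dots,\tau_r\in\mathfrak H$ represent, without repetition, all the elliptic points of $X$ (the classes of points with nontrivial stabilizer in $\Gamma/(\Gamma\cap\{\pm1\})$), and let $e_i\ge 2$ be the order of $\tau_i$, i.e. the order of this stabilizer. Let $t$ be a Hauptmodul of $X$, i.e. a generator over $\mathbb C$ of the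 field of $\Gamma$-invariant meromorphic functions on $\mathfrak H$, and set $a_i=t(\tau_i)\in\mathbb C\cup\{\infty\}$. Let $k\ge4$ be an even integer, and let $S_k(\Gamma)$ be the complex vector space of automorphic forms of weight $k$ on $X$, i.e. of holomorphic functions $f:\mathfrak H\to\mathbb C$ with $f\left(\frac{a\tau+b}{c\tau+d}\right)=(c\tau+d)^kf(\tau)$ for all $\begin{pmatrix}a&b\\c&d\end{pmatrix}\in\Gamma$ and all $\tau\in\mathfrak H$. Then $$d_k:=\dim S_k(\Gamma)=1-k+\sum_{i=1}^r\left\lfloor\frac k2\left(1-\frac1{e_i}\right)\right\rfloor,$$ and the functions $$t'(\tau)^{k/2}\,t(\tau)^j\prod_{1\le i\le r,\ a_i\ne\infty}\bigl(t(\tau)-a_i\bigr)^{-\lfloor k(1-1/e_i)/2\rfloor},\qquad j=0,\dots,d_k-1$$ (with their removable singularities, at points where $t(\tau)\in\{\infty,a_1,\dots,a_r\}$, filled in), form a basis of $S_k(\Gamma)$. -/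

import Mathlib

open scoped MatrixGroups UpperHalfPlane Topology TensorProduct NumberField Manifold Polynomial

noncomputable section

/-! ### Quaternion algebras, orders, norm-one groups -/

/-- `B` is a quaternion algebra over the field `K`: a central simple `K`-algebra of dimension 4. -/
structure IsQuaternionAlgebra (K B : Type*) [Field K] [Ring B] [Algebra K B] : Prop where
  central : Algebra.IsCentral K B
  simple : IsSimpleRing B
  finrank_eq_four : Module.finrank K B = 4

/-- The quaternion algebra `B` over the totally real field `K` splits at exactly one infinite place:
`ℝ ⊗ B` (over `ℚ`) is isomorphic, as a real algebra, to the product of `M(2, ℝ)` and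
`[K : ℚ] - 1` copies of Hamilton's quaternions. -/
def SplitsAtExactlyOneInfinitePlace (K B : Type*) [Field K] [NumberField K] [Ring B]
    [Algebra ℚ B] : Prop :=
  Nonempty ((ℝ ⊗[ℚ] B) ≃ₐ[ℝ]
    (Matrix (Fin 2) (Fin 2) ℝ × (Fin (Module.finrank ℚ K - 1) → Quaternion ℝ)))

/-- `O` is an order of the `K`-algebra `B`: a subring containing the ring of integers of `K`,
finitely generated as a module over it, and spanning `B` over `K`. -/
structure IsQuaternionOrder {K B : Type*} [Field K] [NumberField K] [Ring B] [Algebra K B]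
    (O : Subalgebra (𝓞 K) B) : Prop where
  finite : Module.Finite (𝓞 K) O
  span_eq_top : Submodule.span K (O : Set B) = ⊤

/-- The group `Γ(O)`, the image in `SL(2, ℝ)` under `ι : B → M(2, ℝ)` of the group of elements of
reduced norm 1 of the order `O`.  (The reduced norm of `x` is the determinant of `ι x`, and elements
of `O` of reduced norm 1 are units of `O`.) -/
def normOneGroup {K B : Type*} [Field K] [NumberField K] [Ring B] [Algebra K B]
    (ι : B →+* Matrix (Fin 2) (Fin 2) ℝ) (O : Subalgebra (𝓞 K) B) : Subgroup SL(2, ℝ) :=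
  (Units.map (ι.comp O.val.toRingHom : O →* Matrix (Fin 2) (Fin 2) ℝ)).range.comap
    (Matrix.SpecialLinearGroup.toGL : SL(2, ℝ) →* GL (Fin 2) ℝ)

/-! ### Meromorphic functions on the upper half-plane, as maps to the Riemann sphere -/

/-- The complex number underlying a finite point of the Riemann sphere (junk value `0` at `∞`). -/
def sphereToComplex (x : OnePoint ℂ) : ℂ := x.elim 0 id

/-- The finite part of a function from the upper half-plane to the Riemann sphere, as a function of
a complex variable (only its values on the upper half-plane matter). -/
def finitePart (f : ℍ → OnePoint ℂ) (z : ℂ) : ℂ := sphereToComplex (f (UpperHalfPlane.ofComplex z))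

/-- `f : ℍ → ℂ ∪ {∞}` is a meromorphic function on the upper half-plane, taking the value `∞` exactly
at its poles: it is continuous as a map to the Riemann sphere, the value `∞` is taken at isolated
points only, and the finite part is meromorphic. -/
structure IsMeromorphicOnUpperHalfPlane (f : ℍ → OnePoint ℂ) : Prop where
  continuous : Continuous f
  isolated_poles : ∀ τ : ℍ, ∀ᶠ z in 𝓝[≠] τ, f z ≠ OnePoint.infty
  meromorphicAt : ∀ τ : ℍ, MeromorphicAt (finitePart f) (τ : ℂ)

/-- The automorphic functions on `Γ`: the `Γ`-invariant meromorphic functions on the upper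
half-plane. -/
structure IsAutomorphicFunction (Γ : Subgroup SL(2, ℝ)) (f : ℍ → OnePoint ℂ) : Prop where
  meromorphic : IsMeromorphicOnUpperHalfPlane f
  invariant : ∀ γ ∈ Γ, ∀ τ : ℍ, f (γ • τ) = f τ

/-- The Riemann surface `Γ \ ℍ` has genus zero: it is isomorphic to the Riemann sphere.  (A map on
`Γ \ ℍ` is holomorphic if and only if its composition with `ℍ → Γ \ ℍ` is.) -/
def HasGenusZero (Γ : Subgroup SL(2, ℝ)) : Prop :=
  ∃ φ : MulAction.orbitRel.Quotient Γ ℍ ≃ₜ OnePoint ℂ,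
    IsMeromorphicOnUpperHalfPlane fun τ : ℍ => φ (Quotient.mk (MulAction.orbitRel Γ ℍ) τ)

/-- `t` is a Hauptmodul of `Γ`: it is an automorphic function on `Γ` that generates the field of
automorphic functions on `Γ` over `ℂ`, i.e. every automorphic function is `p(t) / q(t)` with
polynomials `p`, `q` such that `q(t)` is not identically zero. -/
structure IsHauptmodul (Γ : Subgroup SL(2, ℝ)) (t : ℍ → OnePoint ℂ) : Prop where
  automorphic : IsAutomorphicFunction Γ t
  generates : ∀ f : ℍ → OnePoint ℂ, IsAutomorphicFunction Γ f →
    ∃ p q : ℂ[X],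
      (∃ τ : ℍ, t τ ≠ OnePoint.infty ∧ q.eval (sphereToComplex (t τ)) ≠ 0) ∧
      ∀ τ : ℍ, f τ ≠ OnePoint.infty → t τ ≠ OnePoint.infty →
        sphereToComplex (f τ) * q.eval (sphereToComplex (t τ)) =
          p.eval (sphereToComplex (t τ))

/-! ### Elliptic points -/

/-- The order of the stabilizer of `τ` in `Γ / (Γ ∩ {±1})`. -/
def stabilizerOrder (Γ : Subgroup SL(2, ℝ)) (τ : ℍ) : ℕ :=
  Nat.card ((Γ ⊓ MulAction.stabilizer SL(2, ℝ) τ).map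
    (QuotientGroup.mk' (Subgroup.center SL(2, ℝ))))

/-- `τ 1, …, τ r` represent, without repetition, all the elliptic points of `Γ \ ℍ` (the classes of
points whose stabilizer in `Γ / (Γ ∩ {±1})` is nontrivial), and `e i` is the order of `τ i`. -/
structure AreEllipticPoints (Γ : Subgroup SL(2, ℝ)) {r : ℕ} (τ : Fin r → ℍ) (e : Fin r → ℕ) :
    Prop where
  order_eq : ∀ i, stabilizerOrder Γ (τ i) = e i
  one_lt : ∀ i, 1 < e i
  inequivalent : ∀ i j, (∃ γ ∈ Γ, γ • τ i = τ j) → i = j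
  exhaustive : ∀ z : ℍ, stabilizerOrder Γ z ≠ 1 → ∃ i, ∃ γ ∈ Γ, γ • τ i = z

/-! ### Automorphic forms -/

/-- The space `S_k(Γ)` of automorphic forms of weight `k` on a group `Γ` without cusps: holomorphic
functions on the upper half-plane with `f((aτ + b)/(cτ + d)) = (cτ + d)^k f(τ)` for all
`(a, b; c, d)` in `Γ`. -/
def automorphicForms (Γ : Subgroup SL(2, ℝ)) (k : ℕ) : Submodule ℂ (ℍ → ℂ) where
  carrier := {f | MDifferentiable 𝓘(ℂ) 𝓘(ℂ) f ∧ ∀ γ ∈ Γ, ∀ τ : ℍ,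
    f (γ • τ) = ((γ.1 1 0 : ℂ) * (τ : ℂ) + (γ.1 1 1 : ℂ)) ^ k * f τ}
  add_mem' := by
    rintro f g ⟨hf, hf'⟩ ⟨hg, hg'⟩
    refine ⟨hf.add hg, fun γ hγ τ => ?_⟩
    simp only [Pi.add_apply, hf' γ hγ τ, hg' γ hγ τ, mul_add]
  zero_mem' := ⟨mdifferentiable_const, fun γ _ τ => by simp⟩
  smul_mem' := by
    rintro c f ⟨hf, hf'⟩
    refine ⟨hf.const_smul c, fun γ hγ τ => ?_⟩
    simp only [Pi.smul_apply, smul_eq_mul, hf' γ hγ τ]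
    ring

end

/-! Write `k = 2m`. Genus zero makes the quotient homeomorphic to the sphere, hence compact, and all
global input is the maximum principle on it: an invariant holomorphic function is constant, and a
holomorphic form of negative weight vanishes (`eq_const_of_weight_zero`, `eq_zero_of_weight_neg`).
Neither Riemann-Roch nor a degree theory of divisors is needed.

Since the isomorphism to the sphere is a rational function of `t`, the Hauptmodul separates orbits
(`isUniformizer_of_isHauptmodul`). Counting a nearby fibre then shows that the ramification index of
`t` at a point is the order of its stabilizer (`stabilizerOrder_eq_of_fibres`), and invariant
functions have orders divisible by it (`dvd_order_of_factors`).

Let `B` be the product of `t' ^ m` and the powers of `t - a i`. By `meromorphicOrderAt_baseForm`, at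
a point of order `e` where `t` is finite, `B` has order `m(e-1) - e⌊m(1-1/e)⌋`, which lies in `[0,
e)`; over `∞` there is an additional `e(d-1)`, where `d` is the claimed dimension. Hence `B t^j` is
holomorphic for `j < d`. Conversely, if `f` is a form, then `f / B` is invariant and its order
exceeds `-e` where `t` is finite, so divisibility makes it nonnegative; over `∞` the same argument
bounds the pole by `e(d-1)`. Removing leading terms shows that `f / B` is a polynomial in `t` of
degree less than `d` (`exists_eq_sum_pow`).

It remains to see that `d ≥ 0`. This follows for `m ≥ 2` from `∑ (1 - 1/e i) > 2` (`two_lt_sum`),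
since otherwise a suitable form has a nonzero holomorphic inverse of negative weight. -/

noncomputable section

namespace ShimuraGenusZero

open Filter Set UpperHalfPlane

/-! ### The action of `SL(2, ℝ)` on the upper half-plane -/

/-- The automorphy factor `cτ + d`. -/
def autFactor (γ : SL(2, ℝ)) (τ : ℍ) : ℂ := (γ.1 1 0 : ℂ) * (τ : ℂ) + (γ.1 1 1 : ℂ)

lemma det_toGL_pos (γ : SL(2, ℝ)) :
    0 < ((Matrix.SpecialLinearGroup.mapGL ℝ γ : GL (Fin 2) ℝ).val).det := by
  simp

lemma smul_eq_mapGL_smul (γ : SL(2, ℝ)) (τ : ℍ) :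
    γ • τ = (Matrix.SpecialLinearGroup.mapGL ℝ γ : GL (Fin 2) ℝ) • τ := rfl

lemma denom_mapGL (γ : SL(2, ℝ)) (τ : ℍ) :
    denom (Matrix.SpecialLinearGroup.mapGL ℝ γ : GL (Fin 2) ℝ) τ = autFactor γ τ := by
  simp [denom, autFactor]

lemma autFactor_ne_zero (γ : SL(2, ℝ)) (τ : ℍ) : autFactor γ τ ≠ 0 := by
  rw [← denom_mapGL]; exact denom_ne_zero _ _

lemma continuous_autFactor (γ : SL(2, ℝ)) : Continuous (autFactor γ) :=
  (continuous_const.mul continuous_coe).add continuous_const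

lemma im_smul_eq (γ : SL(2, ℝ)) (τ : ℍ) : (γ • τ).im = τ.im / ‖autFactor γ τ‖ ^ 2 := by
  have := UpperHalfPlane.im_smul_eq_div_normSq (Matrix.SpecialLinearGroup.mapGL ℝ γ) τ
  rw [denom_mapGL, Complex.normSq_eq_norm_sq] at this
  rw [smul_eq_mapGL_smul, this]
  simp

lemma hasDerivAt_smul (γ : SL(2, ℝ)) (τ : ℍ) :
    HasDerivAt (fun z : ℂ => ((γ • ofComplex z : ℍ) : ℂ)) (1 / autFactor γ τ ^ 2) τ := by
  have := (hasStrictDerivAt_smul (det_toGL_pos γ) τ).hasDerivAt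
  rw [denom_mapGL] at this
  simpa using! this

lemma map_coe_nhdsNE (τ : ℍ) : map ((↑) : ℍ → ℂ) (𝓝[≠] τ) = 𝓝[≠] (τ : ℂ) := by
  rw [isOpenEmbedding_coe.isEmbedding.map_nhdsWithin_eq, image_compl_eq_range_sdiff_image
    isOpenEmbedding_coe.injective, image_singleton, sdiff_eq, nhdsWithin_inter_of_mem]
  exact nhdsWithin_le_nhds (isOpenEmbedding_coe.isOpen_range.mem_nhds (mem_range_self τ))

lemma eventually_nhdsNE_coe {τ : ℍ} {p : ℂ → Prop} :
    (∀ᶠ z in 𝓝[≠] (τ : ℂ), p z) ↔ ∀ᶠ z : ℍ in 𝓝[≠] τ, p z := by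
  rw [← map_coe_nhdsNE, eventually_map]

lemma eventually_nhds_coe {τ : ℍ} {p : ℂ → Prop} :
    (∀ᶠ z in 𝓝 (τ : ℂ), p z) ↔ ∀ᶠ z : ℍ in 𝓝 τ, p z := by
  rw [← isOpenEmbedding_coe.map_nhds_eq, eventually_map]

lemma tendsto_nhdsNE_coe {α : Type*} {τ : ℍ} {f : ℂ → α} {l : Filter α} :
    Tendsto f (𝓝[≠] (τ : ℂ)) l ↔ Tendsto (fun z : ℍ => f z) (𝓝[≠] τ) l := by
  rw [← map_coe_nhdsNE, tendsto_map'_iff]; rfl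

instance (τ : ℍ) : (𝓝[≠] τ).NeBot := by
  have : (map ((↑) : ℍ → ℂ) (𝓝[≠] τ)).NeBot := by rw [map_coe_nhdsNE]; infer_instance
  exact this.of_map

lemma continuous_smul_const (γ : SL(2, ℝ)) : Continuous (fun z : ℍ => γ • z) :=
  (isometry_smul ℍ γ).continuous

lemma tendsto_smul_nhdsNE (γ : SL(2, ℝ)) (τ : ℍ) :
    Tendsto (fun z : ℍ => γ • z) (𝓝[≠] τ) (𝓝[≠] (γ • τ)) := by
  refine tendsto_nhdsWithin_of_tendsto_nhds_of_eventually_within _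
    ((continuous_smul_const γ).continuousAt.tendsto.mono_left nhdsWithin_le_nhds) ?_
  filter_upwards [self_mem_nhdsWithin] with z hz h
  exact hz (MulAction.injective γ h)

/-- An element of `SL(2, ℝ)` with two fixed points in the upper half-plane is central. -/
lemma mem_center_of_fixes_two {γ : SL(2, ℝ)} {z w : ℍ} (hz : γ • z = z) (hw : γ • w = w)
    (hzw : z ≠ w) : γ ∈ Subgroup.center SL(2, ℝ) := by
  by_contra hc
  have hc' : (Matrix.SpecialLinearGroup.mapGL ℝ γ : GL (Fin 2) ℝ) ∉ Subgroup.center _ := by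
    intro h
    apply hc
    rw [Subgroup.mem_center_iff] at h ⊢
    intro g
    apply Matrix.SpecialLinearGroup.mapGL_injective (S := ℝ)
    simpa using h (Matrix.SpecialLinearGroup.mapGL ℝ g)
  have hell := isElliptic_of_exists_smul_eq_self (det_toGL_pos γ) hc' ⟨z, hz⟩
  exact hzw (((gl_smul_eq_self_iff_eq_fixedPt (det_toGL_pos γ) hell).1 hz).trans
    ((gl_smul_eq_self_iff_eq_fixedPt (det_toGL_pos γ) hell).1 hw).symm)

lemma smul_eq_self_of_mem_center {γ : SL(2, ℝ)} (hγ : γ ∈ Subgroup.center SL(2, ℝ)) (z : ℍ) :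
    γ • z = z := by
  obtain ⟨g, rfl⟩ := MulAction.exists_smul_eq SL(2, ℝ) I z
  have h0 : γ • I = I := by
    rw [Matrix.SpecialLinearGroup.mem_center_iff] at hγ
    obtain ⟨r, hr, hγ⟩ := hγ
    have hr0 : r ≠ 0 := by rintro rfl; simp at hr
    ext
    rw [coe_specialLinearGroup_apply, ← hγ]
    have : (r : ℂ) ≠ 0 := by exact_mod_cast hr0
    simp [Matrix.scalar_apply]
    field_simp
  rw [← mul_smul, ← Subgroup.mem_center_iff.1 hγ g, mul_smul, h0]

/-! ### Holomorphic functions of weight `-2N` on a compact quotient -/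

/-- With the Cayley coordinate `ζ = (z - w) / (z - w̄)`, the left side is `(1 - |ζ|²) / (4 Im w)`,
so equality holds exactly at `z = w`. This lets a maximum of `|g| y^{-N}` at `w` become a maximum of
the holomorphic function `g / (z - w̄)^{2N}`. -/
lemma im_div_norm_sub_conj_sq_le (z w : ℍ) :
    z.im / ‖(z : ℂ) - (starRingEnd ℂ) w‖ ^ 2 ≤ 1 / (4 * w.im) := by
  have hz := z.im_pos
  have hw := w.im_pos
  rw [← Complex.normSq_eq_norm_sq, Complex.normSq_apply]
  simp only [Complex.sub_re, Complex.conj_re, Complex.sub_im, Complex.conj_im, coe_re, coe_im]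
  rw [div_le_div_iff₀ (by nlinarith [sq_nonneg (z.re - w.re), mul_pos hz hw]) (by positivity)]
  nlinarith [sq_nonneg (z.re - w.re), sq_nonneg (z.im - w.im)]

lemma sub_conj_ne_zero (z w : ℍ) : (z : ℂ) - (starRingEnd ℂ) w ≠ 0 := by
  intro h
  have := congrArg Complex.im h
  simp at this
  linarith [z.im_pos, w.im_pos]

lemma isPreconnected_upperHalfPlaneSet : IsPreconnected {z : ℂ | 0 < z.im} :=
  (convex_halfSpace_im_gt 0).isPreconnected

/-- If `|g| y^{-N}` attains its maximum, then `g(τ) = c (τ - \bar τ₀)^{2N}` for a constant `c`. -/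
lemma eq_const_mul_of_isMax {N : ℕ} {g : ℍ → ℂ} (hg : MDifferentiable 𝓘(ℂ) 𝓘(ℂ) g) {w : ℍ}
    (hmax : ∀ z, ‖g z‖ / z.im ^ N ≤ ‖g w‖ / w.im ^ N) (z : ℍ) :
    g z / ((z : ℂ) - (starRingEnd ℂ) w) ^ (2 * N) =
      g w / ((w : ℂ) - (starRingEnd ℂ) w) ^ (2 * N) := by
  set h : ℂ → ℂ := fun z => g (ofComplex z) / (z - (starRingEnd ℂ) w) ^ (2 * N) with hh
  have hd : DifferentiableOn ℂ h {z | 0 < z.im} := by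
    refine (UpperHalfPlane.mdifferentiable_iff.1 hg).div (by fun_prop) fun z hz => ?_
    exact pow_ne_zero _ (sub_conj_ne_zero ⟨z, hz⟩ w)
  have hbound : ∀ z : ℍ, ‖h z‖ ≤ ‖h w‖ := by
    intro z
    have e1 : ‖h z‖ = ‖g z‖ / z.im ^ N * (z.im / ‖(z : ℂ) - (starRingEnd ℂ) w‖ ^ 2) ^ N := by
      have := z.im_pos.ne'
      simp only [hh, ofComplex_apply, norm_div, norm_pow, div_pow, pow_mul]
      field_simp
    have e2 : ‖h w‖ = ‖g w‖ / w.im ^ N * (1 / (4 * w.im)) ^ N := by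
      have hw := w.im_pos.ne'
      have : ‖(w : ℂ) - (starRingEnd ℂ) w‖ ^ 2 = 4 * w.im ^ 2 := by
        rw [← Complex.normSq_eq_norm_sq, Complex.normSq_apply]
        simp
        ring
      simp only [hh, ofComplex_apply, norm_div, norm_pow, pow_mul, this]
      rw [div_pow, mul_pow, mul_pow, ← pow_mul, mul_comm 2 N, pow_mul, one_pow]
      field_simp
    rw [e1, e2]
    refine mul_le_mul (hmax z) (pow_le_pow_left₀ ?_ (im_div_norm_sub_conj_sq_le z w) N) ?_ ?_
    · have := z.im_pos; positivity
    · have := z.im_pos; positivity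
    · have := w.im_pos; positivity
  have := Complex.eqOn_of_isPreconnected_of_isMaxOn_norm isPreconnected_upperHalfPlaneSet
    isOpen_upperHalfPlaneSet hd w.im_pos (fun z hz => hbound ⟨z, hz⟩) z.im_pos
  simpa [hh] using this

/-- Since `Im (γz) = Im z / |cz + d|²`, the function `|g| y^{-N}` is invariant and descends to the
compact quotient. -/
lemma exists_isMax_of_compact (Γ : Subgroup SL(2, ℝ))
    [CompactSpace (MulAction.orbitRel.Quotient Γ ℍ)] (N : ℕ) {g : ℍ → ℂ} (hg : Continuous g)
    (hinv : ∀ γ ∈ Γ, ∀ z : ℍ, g (γ • z) * autFactor γ z ^ (2 * N) = g z) :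
    ∃ w : ℍ, ∀ z, ‖g z‖ / z.im ^ N ≤ ‖g w‖ / w.im ^ N := by
  let F : MulAction.orbitRel.Quotient Γ ℍ → ℝ := Quotient.lift (fun z : ℍ => ‖g z‖ / z.im ^ N) (by
    rintro a b ⟨⟨γ, hγ⟩, rfl⟩
    change ‖g (γ • b)‖ / (γ • b).im ^ N = ‖g b‖ / b.im ^ N
    have hb := b.im_pos.ne'
    have hj : ‖autFactor γ b‖ ≠ 0 := norm_ne_zero_iff.2 (autFactor_ne_zero γ b)
    rw [← hinv γ hγ b, im_smul_eq, norm_mul, norm_pow, div_pow, pow_mul]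
    field_simp)
  have hF : Continuous F := by
    refine Continuous.quotient_lift ?_ _
    exact hg.norm.div (continuous_im.pow N) fun z => pow_ne_zero _ z.im_pos.ne'
  obtain ⟨q, -, hq⟩ := isCompact_univ.exists_isMaxOn
    (⟨Quotient.mk _ I, mem_univ _⟩ : (univ : Set (MulAction.orbitRel.Quotient Γ ℍ)).Nonempty)
    hF.continuousOn
  induction q using Quotient.inductionOn with
  | h w => exact ⟨w, fun z => hq (mem_univ (Quotient.mk _ z))⟩

/-- A holomorphic function of weight zero on a compact quotient is constant. -/
theorem eq_const_of_weight_zero (Γ : Subgroup SL(2, ℝ))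
    [CompactSpace (MulAction.orbitRel.Quotient Γ ℍ)] {g : ℍ → ℂ}
    (hg : MDifferentiable 𝓘(ℂ) 𝓘(ℂ) g) (hinv : ∀ γ ∈ Γ, ∀ z : ℍ, g (γ • z) = g z) :
    ∃ c, ∀ z, g z = c := by
  obtain ⟨w, hw⟩ := exists_isMax_of_compact Γ 0 hg.continuous (by simpa using hinv)
  exact ⟨g w, fun z => by simpa using eq_const_mul_of_isMax hg hw z⟩

/-- A holomorphic function of negative weight on a compact quotient vanishes. -/
theorem eq_zero_of_weight_neg (Γ : Subgroup SL(2, ℝ))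
    [CompactSpace (MulAction.orbitRel.Quotient Γ ℍ)] {N : ℕ} (hN : N ≠ 0) {g : ℍ → ℂ}
    (hg : MDifferentiable 𝓘(ℂ) 𝓘(ℂ) g)
    (hinv : ∀ γ ∈ Γ, ∀ z : ℍ, g (γ • z) * autFactor γ z ^ (2 * N) = g z) (z : ℍ) : g z = 0 := by
  obtain ⟨w, hw⟩ := exists_isMax_of_compact Γ N hg.continuous hinv
  have hwim := w.im_pos
  suffices hgw : g w = 0 by
    have := eq_const_mul_of_isMax hg hw z
    rw [hgw, zero_div, div_eq_zero_iff] at this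
    exact this.resolve_right (pow_ne_zero _ (sub_conj_ne_zero z w))
  by_contra hgw
  -- Going up from `w` to `v` doubles the imaginary part, so maximality allows `|g|` to grow by at
  -- most `2^N`; the explicit form `c (z - w̄)^{2N}` makes it grow by `(3/2)^{2N} = (9/4)^N`. The
  -- contradiction is `8^N < 9^N`.
  let v : ℍ := ⟨(w : ℂ) + w.im * Complex.I, by simp; linarith⟩
  have hv : v.im = 2 * w.im := by rw [← coe_im]; simp [v]; ring
  have h1 := congrArg norm (eq_const_mul_of_isMax hg hw v)
  have h2 := hw v
  have e1 : (w : ℂ) - (starRingEnd ℂ) w = 2 * w.im * Complex.I := by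
    apply Complex.ext
    · simp
    · simp; ring
  have e2 : (v : ℂ) - (starRingEnd ℂ) w = 3 * w.im * Complex.I := by
    apply Complex.ext
    · simp [v]
    · simp [v]; ring
  rw [e1, e2, norm_div, norm_div, norm_pow, norm_pow] at h1
  simp only [norm_mul, Complex.norm_I, Complex.norm_real, Real.norm_eq_abs, abs_of_pos hwim,
    Complex.norm_ofNat, mul_one] at h1
  rw [hv] at h2
  have hpos : 0 < ‖g w‖ := norm_pos_iff.2 hgw
  rw [div_eq_div_iff (by positivity) (by positivity)] at h1
  rw [div_le_div_iff₀ (by positivity) (by positivity)] at h2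
  have hc : (0 : ℝ) < w.im ^ N := by positivity
  have h3 : ‖g v‖ ≤ ‖g w‖ * 2 ^ N := by
    rw [mul_pow] at h2
    nlinarith
  have h4 : ‖g v‖ * 4 ^ N = ‖g w‖ * 9 ^ N := by
    rw [mul_pow, mul_pow, pow_mul 2, pow_mul 3] at h1
    norm_num at h1
    have : (0 : ℝ) < w.im ^ (2 * N) := by positivity
    apply mul_right_cancel₀ this.ne'
    linarith
  have h5 : (8 : ℝ) ^ N < 9 ^ N := pow_lt_pow_left₀ (by norm_num) (by norm_num) hN
  have h6 : (2 : ℝ) ^ N * 4 ^ N = 8 ^ N := by rw [← mul_pow]; norm_num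
  have h7 : (0 : ℝ) < 4 ^ N := by positivity
  nlinarith

/-! ### Local normal form of analytic functions -/

lemma exists_local_inverse {h : ℂ → ℂ} {z₀ : ℂ} (hh : AnalyticAt ℂ h z₀) (hd : deriv h z₀ ≠ 0) :
    ∃ k : ℂ → ℂ, AnalyticAt ℂ k (h z₀) ∧ deriv k (h z₀) ≠ 0 ∧ k (h z₀) = z₀ ∧
      (∀ᶠ z in 𝓝 z₀, k (h z) = z) ∧ ∀ᶠ w in 𝓝 (h z₀), h (k w) = w := by
  have hs : HasStrictFDerivAt h _ z₀ := hh.hasStrictDerivAt.hasStrictFDerivAt_equiv hd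
  refine ⟨hh.hasStrictDerivAt.localInverse _ _ _ hd, hh.analyticAt_localInverse hd, ?_,
    hs.localInverse_apply_image, hs.eventually_left_inverse, hs.eventually_right_inverse⟩
  rw [(hh.hasStrictDerivAt.to_localInverse hd).hasDerivAt.deriv]
  exact inv_ne_zero hd

/-- An analytic function vanishing to order `n ≠ 0` is locally the `n`-th power of a local
coordinate. -/
lemma exists_eq_pow {u : ℂ → ℂ} {z₀ : ℂ} {n : ℕ} (hn : n ≠ 0) (hu : AnalyticAt ℂ u z₀)
    (ho : analyticOrderAt u z₀ = n) :
    ∃ h : ℂ → ℂ, AnalyticAt ℂ h z₀ ∧ h z₀ = 0 ∧ deriv h z₀ ≠ 0 ∧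
      ∀ᶠ z in 𝓝 z₀, u z = h z ^ n := by
  obtain ⟨g, hg, hg0, hug⟩ := hu.analyticOrderAt_eq_natCast.1 ho
  obtain ⟨c, hc⟩ := IsAlgClosed.exists_pow_nat_eq (g z₀) (Nat.pos_of_ne_zero hn)
  have hc0 : c ≠ 0 := by rintro rfl; rw [zero_pow hn] at hc; exact hg0 hc.symm
  -- Dividing by `g z₀` brings the base of the power to `1` at `z₀`, away from the branch cut; the
  -- constant `c` restores the correct `n`-th power.
  set k : ℂ → ℂ := fun z => c * (g z / g z₀) ^ ((n : ℂ)⁻¹) with hk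
  have hka : AnalyticAt ℂ k z₀ := by
    refine analyticAt_const.mul (AnalyticAt.cpow (hg.div analyticAt_const hg0) analyticAt_const ?_)
    rw [div_self hg0]
    exact Complex.one_mem_slitPlane
  have hk0 : k z₀ = c := by simp [hk, div_self hg0]
  refine ⟨fun z => (z - z₀) * k z, by fun_prop, by simp, ?_, ?_⟩
  · have := ((hasDerivAt_id z₀).sub_const z₀).mul hka.differentiableAt.hasDerivAt
    have h2 := this.deriv
    simp only [id, sub_self, one_mul, zero_mul, add_zero, hk0] at h2
    have h3 : deriv (fun z => (z - z₀) * k z) z₀ = c := h2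
    rw [h3]
    exact hc0
  · filter_upwards [hug] with z hz
    rw [hz, mul_pow, hk]
    simp only [mul_pow, Complex.cpow_nat_inv_pow _ hn, hc, smul_eq_mul]
    field_simp

/-- In the coordinate `h`, with inverse `k`, the function `u` is `w ↦ w ^ n`, so its fibres are the
orbits of multiplication by `n`-th roots of unity. -/
lemma exists_normal_form {u : ℂ → ℂ} {z₀ : ℂ} {n : ℕ} (hn : n ≠ 0) (hu : AnalyticAt ℂ u z₀)
    (ho : analyticOrderAt u z₀ = n) :
    ∃ h k : ℂ → ℂ, ContinuousAt h z₀ ∧ h z₀ = 0 ∧ (∀ᶠ z in 𝓝 z₀, u z = h z ^ n) ∧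
      AnalyticAt ℂ k 0 ∧ deriv k 0 ≠ 0 ∧ k 0 = z₀ ∧
      (∀ᶠ z in 𝓝 z₀, k (h z) = z) ∧ ∀ᶠ w in 𝓝 0, h (k w) = w := by
  obtain ⟨h, ha, h0, hd, hp⟩ := exists_eq_pow hn hu ho
  obtain ⟨k, hk⟩ := exists_local_inverse ha hd
  rw [h0] at hk
  exact ⟨h, k, ha.continuousAt, h0, hp, hk⟩

/-- If `F` is constant on the fibres of an analytic function `u` vanishing to order `n`, then the
order of `F` is divisible by `n`. -/
theorem dvd_order_of_factors {u F : ℂ → ℂ} {z₀ : ℂ} {n : ℕ} (hn : n ≠ 0) (hu : AnalyticAt ℂ u z₀)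
    (ho : analyticOrderAt u z₀ = n) {U : Set ℂ} (hU : U ∈ 𝓝[≠] z₀)
    (hF : ∀ z ∈ U, ∀ w ∈ U, u z = u w → F z = F w) (hFm : MeromorphicAt F z₀) {N : ℤ}
    (hN : meromorphicOrderAt F z₀ = N) : (n : ℤ) ∣ N := by
  obtain ⟨h, k, hc, h0, hp, hk, hk', hk0, hl, hr⟩ := exists_normal_form hn hu ho
  have hζ := Complex.isPrimitiveRoot_exp n hn
  set ζ := Complex.exp (2 * Real.pi * Complex.I / n)
  have hζ0 : ζ ≠ 0 := Complex.exp_ne_zero _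
  have hcomp : meromorphicOrderAt (F ∘ k) 0 = N := by
    rw [meromorphicOrderAt_comp_of_deriv_ne_zero hk hk', hk0, hN]
  have hm : MeromorphicAt (F ∘ k) 0 :=
    (meromorphicAt_comp_iff_of_deriv_ne_zero hk hk').2 (by rwa [hk0])
  obtain ⟨G, hG, hG0, hFG⟩ := (meromorphicOrderAt_eq_int_iff hm).1 hcomp
  have hkt : Tendsto k (𝓝[≠] 0) (𝓝[≠] z₀) := by
    refine tendsto_nhdsWithin_of_tendsto_nhds_of_eventually_within _ ?_ ?_
    · have := hk.continuousAt.tendsto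
      rw [hk0] at this
      exact this.mono_left nhdsWithin_le_nhds
    · filter_upwards [self_mem_nhdsWithin, nhdsWithin_le_nhds hr] with w hw hw' hkw
      rw [mem_singleton_iff] at hkw
      rw [hkw, h0] at hw'
      exact hw hw'.symm
  have hkU : ∀ᶠ w in 𝓝[≠] (0 : ℂ), k w ∈ U ∧ u (k w) = w ^ n := by
    filter_upwards [hkt hU, hkt (nhdsWithin_le_nhds hp), nhdsWithin_le_nhds hr] with w h1 h2 h3
    refine ⟨h1, ?_⟩
    have h2 : u (k w) = h (k w) ^ n := h2
    rw [h2, h3]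
  have hrot : Tendsto (fun w : ℂ => ζ * w) (𝓝[≠] 0) (𝓝[≠] 0) := by
    refine tendsto_nhdsWithin_of_tendsto_nhds_of_eventually_within _ ?_ ?_
    · have : Tendsto (fun w : ℂ => ζ * w) (𝓝 0) (𝓝 (ζ * 0)) := tendsto_id.const_mul ζ
      rw [mul_zero] at this
      exact this.mono_left nhdsWithin_le_nhds
    · filter_upwards [self_mem_nhdsWithin] with w hw
      exact mul_ne_zero hζ0 hw
  -- `F ∘ k = w ^ N * G` is invariant under `w ↦ ζ w`, because `w ^ n` is. Letting `w → 0` leaves `ζ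
  -- ^ N = 1`.
  have heq : ∀ᶠ w in 𝓝[≠] (0 : ℂ), ζ ^ N * G (ζ * w) = G w := by
    filter_upwards [hkU, hrot.eventually hkU, hFG, hrot.eventually hFG, self_mem_nhdsWithin]
      with w h1 h2 h3 h4 hw
    have h5 : F (k (ζ * w)) = F (k w) := by
      apply hF _ h2.1 _ h1.1
      rw [h1.2, h2.2, mul_pow, hζ.pow_eq_one, one_mul]
    simp only [Function.comp_apply, sub_zero, smul_eq_mul] at h3 h4
    rw [h3, h4, mul_zpow] at h5
    have : w ^ N ≠ 0 := zpow_ne_zero _ hw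
    apply mul_left_cancel₀ this
    linear_combination h5
  have hGt : Tendsto G (𝓝[≠] 0) (𝓝 (G 0)) := hG.continuousAt.tendsto.mono_left nhdsWithin_le_nhds
  have hlim : Tendsto (fun w => ζ ^ N * G (ζ * w)) (𝓝[≠] 0) (𝓝 (ζ ^ N * G 0)) :=
    (hGt.comp hrot).const_mul _
  have := tendsto_nhds_unique (hlim.congr' heq) hGt
  exact (hζ.zpow_eq_one_iff_dvd N).1 (mul_right_cancel₀ hG0 (by rw [this, one_mul]))

lemma natCard_pow_eq {n : ℕ} (hn : n ≠ 0) {a : ℂ} (ha : a ≠ 0) :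
    Nat.card {w : ℂ | w ^ n = a ^ n} = n := by
  classical
  have hζ := Complex.isPrimitiveRoot_exp n hn
  have hset : {w : ℂ | w ^ n = a ^ n} = ↑(Polynomial.nthRoots n (a ^ n)).toFinset := by
    ext w
    simp [Polynomial.mem_nthRoots (Nat.pos_of_ne_zero hn)]
  rw [hset, Nat.card_coe_set_eq, ncard_coe_finset,
    Multiset.toFinset_card_of_nodup (hζ.nthRoots_nodup (pow_ne_zero n ha)), hζ.card_nthRoots,
    if_pos ⟨a, rfl⟩]

lemma natCard_range_eq {α β γ : Type*} (f : α → β) (g : α → γ)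
    (hfg : ∀ a b, f a = f b ↔ g a = g b) : Nat.card (range f) = Nat.card (range g) := by
  refine Nat.card_congr ((Setoid.quotientKerEquivRange f).symm.trans
    ((Quotient.congrRight fun a b => ?_).trans (Setoid.quotientKerEquivRange g)))
  exact hfg a b

/-- If `u` is an analytic function near `τ` whose fibres are the orbits of `Γ`, then the order of
vanishing of `u` at `τ` is the order of the stabilizer of `τ`. -/
theorem stabilizerOrder_eq_of_fibres (Γ : Subgroup SL(2, ℝ)) {u : ℂ → ℂ} {τ : ℍ} {n : ℕ}
    (hn : n ≠ 0) (hu : AnalyticAt ℂ u τ) (ho : analyticOrderAt u τ = n) {U : Set ℍ} (hU : U ∈ 𝓝 τ)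
    (hfib : ∀ z ∈ U, ∀ w ∈ U, u z = u w ↔ ∃ γ ∈ Γ, γ • z = w) :
    stabilizerOrder Γ τ = n := by
  obtain ⟨h, k, hc, h0, hp, hk, hk', hk0, hl, hr⟩ := exists_normal_form hn hu ho
  obtain ⟨ε, hε, hball⟩ := Metric.mem_nhds_iff.1
    (inter_mem hU (inter_mem (eventually_nhds_coe.1 hp) (eventually_nhds_coe.1 hl)))
  have hτball : τ ∈ Metric.ball τ ε := Metric.mem_ball_self hε
  have hinj : ∀ z ∈ Metric.ball τ ε, ∀ w ∈ Metric.ball τ ε, h z = h w → z = w := by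
    intro z hz w hw hzw
    have h1 : k (h z) = z := (hball hz).2.2
    have h2 : k (h w) = w := (hball hw).2.2
    rw [hzw, h2] at h1
    exact (UpperHalfPlane.ext h1).symm
  have hup : ∀ z ∈ Metric.ball τ ε, u z = h z ^ n := fun z hz => (hball hz).2.1
  have hfix : ∀ γ ∈ Γ, γ • τ ∈ Metric.ball τ ε → γ • τ = τ := by
    intro γ hγ hmem
    have h1 := (hfib τ (hball hτball).1 _ (hball hmem).1).2 ⟨γ, hγ, rfl⟩
    rw [hup _ hτball, hup _ hmem, h0, zero_pow hn] at h1
    refine hinj _ hmem _ hτball ?_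
    rw [h0]
    exact pow_eq_zero_iff hn |>.1 h1.symm
  -- The radius is halved so that an element of `Γ` carrying one point of the small ball to another
  -- moves `τ` by less than `ε`; by `hfix` it then fixes `τ`.
  have hk2 : ∀ᶠ w in 𝓝 (0 : ℂ), ∃ z ∈ Metric.ball τ (ε / 2), (z : ℂ) = k w := by
    have : (UpperHalfPlane.coe '' Metric.ball τ (ε / 2)) ∈ 𝓝 (k 0) := by
      rw [hk0]
      exact isOpenEmbedding_coe.isOpenMap.image_mem_nhds (Metric.ball_mem_nhds _ (by positivity))
    exact hk.continuousAt this
  obtain ⟨δ, hδ, hδball⟩ := Metric.eventually_nhds_iff_ball.1 (hk2.and hr)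
  have hsmall : ∀ᶠ z : ℍ in 𝓝[≠] τ, h z ∈ Metric.ball (0 : ℂ) δ := by
    have h1 : ∀ᶠ z in 𝓝 (τ : ℂ), h z ∈ Metric.ball (0 : ℂ) δ := by
      apply hc
      rw [h0]
      exact Metric.ball_mem_nhds _ hδ
    exact nhdsWithin_le_nhds (eventually_nhds_coe.1 h1)
  have hnear : ∀ᶠ z : ℍ in 𝓝[≠] τ, z ∈ Metric.ball τ (ε / 2) :=
    nhdsWithin_le_nhds (Metric.ball_mem_nhds τ (by positivity))
  obtain ⟨z, ⟨hzδ, hzε⟩, hzτ⟩ := ((hsmall.and hnear).and self_mem_nhdsWithin).exists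
  have hzε' : z ∈ Metric.ball τ ε := Metric.ball_subset_ball (by linarith) hzε
  have hz0 : h z ≠ 0 := by
    intro hz
    rw [← h0] at hz
    exact hzτ (hinj _ hzε' _ hτball hz)
  -- The group acts by hyperbolic isometries, so the stabilizer of `τ` preserves balls about `τ`.
  have hstab : ∀ γ ∈ Γ ⊓ MulAction.stabilizer SL(2, ℝ) τ, γ • z ∈ Metric.ball τ ε := by
    rintro γ ⟨-, hγ⟩
    have hγ : γ • τ = τ := hγ
    rw [Metric.mem_ball]
    nth_rewrite 1 [← hγ]
    rw [dist_smul]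
    exact hzε'
  let ψ : ↥(Γ ⊓ MulAction.stabilizer SL(2, ℝ) τ) → ℂ := fun γ => h ((γ.1 • z : ℍ) : ℂ)
  let π : ↥(Γ ⊓ MulAction.stabilizer SL(2, ℝ) τ) → SL(2, ℝ) ⧸ Subgroup.center SL(2, ℝ) :=
    fun γ => QuotientGroup.mk' _ γ.1
  have hrangeπ : (((Γ ⊓ MulAction.stabilizer SL(2, ℝ) τ).map
      (QuotientGroup.mk' (Subgroup.center SL(2, ℝ))) : Subgroup _) : Set _) = range π := by
    ext x
    simp [π]
  -- The fibre of `u` through `z` is at once the stabilizer orbit of `z` and, in the coordinate `h`,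
  -- a set of `n` roots. All these roots have the same modulus as `h z`, so they stay within `δ`,
  -- where `k` inverts `h`.
  have hrangeψ : range ψ = {w | w ^ n = h z ^ n} := by
    ext w
    constructor
    · rintro ⟨γ, rfl⟩
      have h1 := (hfib _ (hball hzε').1 _ (hball (hstab γ.1 γ.2)).1).2 ⟨γ.1, γ.2.1, rfl⟩
      rw [hup _ hzε', hup _ (hstab γ.1 γ.2)] at h1
      exact h1.symm
    · intro hw
      have hnorm : ‖w‖ = ‖h z‖ := by
        have := congrArg norm (show w ^ n = h z ^ n from hw)
        rw [norm_pow, norm_pow] at this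
        exact (pow_left_inj₀ (norm_nonneg _) (norm_nonneg _) hn).1 this
      have hwδ : w ∈ Metric.ball (0 : ℂ) δ := by
        rw [mem_ball_zero_iff] at hzδ ⊢
        rwa [hnorm]
      obtain ⟨⟨z', hz'ε, hz'⟩, hkw⟩ := hδball w hwδ
      have hz'ε' : z' ∈ Metric.ball τ ε := Metric.ball_subset_ball (by linarith) hz'ε
      rw [← hz'] at hkw
      obtain ⟨γ, hγ, hγz⟩ := (hfib _ (hball hzε').1 _ (hball hz'ε').1).1 (by
        rw [hup _ hzε', hup _ hz'ε', hkw]; exact hw.symm)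
      have hfixτ : γ • τ = τ := by
        apply hfix γ hγ
        rw [Metric.mem_ball] at hz'ε hzε ⊢
        calc dist (γ • τ) τ ≤ dist (γ • τ) (γ • z) + dist (γ • z) τ := dist_triangle _ _ _
          _ = dist z τ + dist z' τ := by rw [dist_smul, dist_comm τ z, hγz]
          _ < ε := by linarith
      exact ⟨⟨γ, hγ, hfixτ⟩, by simp only [ψ]; rw [hγz, hkw]⟩
  -- If `a z = b z`, then `a⁻¹ b` fixes both `z` and `τ`, hence is central: the stabilizer modulo
  -- the centre acts freely on the orbit of `z`.
  have hψπ : ∀ a b, ψ a = ψ b ↔ π a = π b := by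
    intro a b
    have ha : a.1 • τ = τ := a.2.2
    have hb : b.1 • τ = τ := b.2.2
    constructor
    · intro hab
      have h1 := hinj _ (hstab a.1 a.2) _ (hstab b.1 b.2) hab
      refine (QuotientGroup.eq).2 (mem_center_of_fixes_two (z := z) (w := τ) ?_ ?_ hzτ)
      · rw [mul_smul, ← h1, inv_smul_smul]
      · rw [mul_smul, hb, inv_smul_eq_iff, ha]
    · intro hab
      have h1 := smul_eq_self_of_mem_center ((QuotientGroup.eq).1 hab) z
      rw [mul_smul, inv_smul_eq_iff] at h1
      simp only [ψ]
      rw [h1]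
  have h1 : stabilizerOrder Γ τ = Nat.card (range π) := by
    rw [stabilizerOrder, ← hrangeπ]; rfl
  rw [h1, ← natCard_range_eq ψ π hψπ, hrangeψ, natCard_pow_eq hn hz0]

/-! ### Local coordinates on the Riemann sphere -/

@[simp] lemma sphereToComplex_coe (x : ℂ) : sphereToComplex (x : OnePoint ℂ) = x := rfl

@[simp] lemma sphereToComplex_infty : sphereToComplex OnePoint.infty = 0 := rfl

lemma coe_sphereToComplex {x : OnePoint ℂ} (hx : x ≠ OnePoint.infty) :
    ((sphereToComplex x : ℂ) : OnePoint ℂ) = x := by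
  induction x using OnePoint.rec with
  | infty => exact absurd rfl hx
  | coe x => rfl

lemma sphereToComplex_injOn : InjOn sphereToComplex {x | x ≠ OnePoint.infty} := by
  intro x hx y hy h
  rw [← coe_sphereToComplex hx, h, coe_sphereToComplex hy]

lemma continuousAt_sphereToComplex {x : OnePoint ℂ} (hx : x ≠ OnePoint.infty) :
    ContinuousAt sphereToComplex x := by
  rw [← coe_sphereToComplex hx, OnePoint.continuousAt_coe]
  exact continuousAt_id

open Classical in
/-- The standard coordinate of the Riemann sphere centred at `a`. -/
def sphereCoord (a x : OnePoint ℂ) : ℂ :=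
  if a = OnePoint.infty then (sphereToComplex x)⁻¹ else sphereToComplex x - sphereToComplex a

@[simp] lemma sphereCoord_self (a : OnePoint ℂ) : sphereCoord a a = 0 := by
  by_cases h : a = OnePoint.infty <;> simp [sphereCoord, h]

lemma continuousAt_sphereCoord (a : OnePoint ℂ) : ContinuousAt (sphereCoord a) a := by
  by_cases h : a = OnePoint.infty
  · subst h
    rw [OnePoint.continuousAt_infty', sphereCoord_self, coclosedCompact_eq_cocompact,
      ← Metric.cobounded_eq_cocompact]
    have : sphereCoord OnePoint.infty ∘ ((↑) : ℂ → OnePoint ℂ) = fun x => x⁻¹ := by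
      funext x; simp [sphereCoord]
    rw [this]
    exact tendsto_inv₀_cobounded
  · have : sphereCoord a = fun x => sphereToComplex x - sphereToComplex a := by
      funext x; simp [sphereCoord, h]
    rw [this]
    exact (continuousAt_sphereToComplex h).sub continuousAt_const

/-- At `∞` the conventions `sphereToComplex ∞ = 0` and `0⁻¹ = 0` give the correct value `0`, but the
point `0` is also sent to `0`, so the neighbourhood of `∞` must omit it. -/
lemma exists_injOn_sphereCoord (a : OnePoint ℂ) : ∃ V ∈ 𝓝 a, InjOn (sphereCoord a) V := by
  by_cases h : a = OnePoint.infty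
  · subst h
    refine ⟨{((0 : ℂ) : OnePoint ℂ)}ᶜ, isOpen_compl_singleton.mem_nhds (by simp), ?_⟩
    have key : ∀ x : OnePoint ℂ, x ≠ ((0 : ℂ) : OnePoint ℂ) → sphereToComplex x = 0 →
        x = OnePoint.infty := by
      intro x hx hx0
      by_contra hxi
      exact hx (by rw [← coe_sphereToComplex hxi, hx0])
    intro x hx y hy hxy
    simp only [sphereCoord, if_true, inv_inj] at hxy
    by_cases hxi : x = OnePoint.infty
    · rw [hxi, sphereToComplex_infty] at hxy
      rw [hxi, key y hy hxy.symm]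
    · by_cases hyi : y = OnePoint.infty
      · rw [hyi, sphereToComplex_infty] at hxy
        rw [hyi, key x hx hxy]
      · exact sphereToComplex_injOn hxi hyi hxy
  · refine ⟨{OnePoint.infty}ᶜ, isOpen_compl_singleton.mem_nhds h, ?_⟩
    intro x hx y hy hxy
    simp only [sphereCoord, h, if_false, sub_left_inj] at hxy
    exact sphereToComplex_injOn hx hy hxy

instance nhdsNE_neBot_sphere (a : OnePoint ℂ) : (𝓝[≠] a).NeBot := by
  induction a using OnePoint.rec <;> infer_instance

/-! ### Meromorphic functions on the upper half-plane -/

lemma finitePart_coe (f : ℍ → OnePoint ℂ) (z : ℍ) : finitePart f z = sphereToComplex (f z) := by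
  simp [finitePart, ofComplex_apply]

/-- The composition of `t` with the coordinate of the sphere centred at `t τ`. -/
def localParam (t : ℍ → OnePoint ℂ) (τ : ℍ) (z : ℂ) : ℂ := sphereCoord (t τ) (t (ofComplex z))

lemma localParam_coe (t : ℍ → OnePoint ℂ) (τ z : ℍ) :
    localParam t τ z = sphereCoord (t τ) (t z) := by
  simp [localParam, ofComplex_apply]

lemma localParam_of_infty {t : ℍ → OnePoint ℂ} {τ : ℍ} (h : t τ = OnePoint.infty) :
    localParam t τ = (finitePart t)⁻¹ := by
  funext z; simp [localParam, sphereCoord, h, finitePart]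

lemma localParam_of_ne_infty {t : ℍ → OnePoint ℂ} {τ : ℍ} (h : t τ ≠ OnePoint.infty) :
    localParam t τ = fun z => finitePart t z - sphereToComplex (t τ) := by
  funext z; simp [localParam, sphereCoord, h, finitePart]

lemma continuousAt_comp_ofComplex {X : Type*} [TopologicalSpace X] {f : ℍ → X} {τ : ℍ}
    (hf : ContinuousAt f τ) : ContinuousAt (fun z : ℂ => f (ofComplex z)) τ := by
  have h1 : ContinuousAt (ofComplex : ℂ → ℍ) τ :=
    (contMDiffAt_ofComplex (n := 1) τ.im_pos).continuousAt
  refine ContinuousAt.comp (g := f) (f := (ofComplex : ℂ → ℍ)) ?_ h1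
  rwa [ofComplex_apply]

section

variable {t : ℍ → OnePoint ℂ} (ht : IsMeromorphicOnUpperHalfPlane t)

include ht

lemma analyticAt_localParam (τ : ℍ) : AnalyticAt ℂ (localParam t τ) τ := by
  refine MeromorphicAt.analyticAt ?_ ?_
  · by_cases h : t τ = OnePoint.infty
    · rw [localParam_of_infty h]
      exact (ht.meromorphicAt τ).inv
    · rw [localParam_of_ne_infty h]
      exact (ht.meromorphicAt τ).sub (MeromorphicAt.const _ _)
  · exact continuousAt_comp_ofComplex (f := fun z => sphereCoord (t τ) (t z))
      ((continuousAt_sphereCoord (t τ)).comp ht.continuous.continuousAt)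

lemma analyticAt_finitePart {τ : ℍ} (h : t τ ≠ OnePoint.infty) :
    AnalyticAt ℂ (finitePart t) τ := by
  refine (ht.meromorphicAt τ).analyticAt ?_
  exact continuousAt_comp_ofComplex (f := fun z => sphereToComplex (t z))
    ((continuousAt_sphereToComplex h).comp ht.continuous.continuousAt)

/-- A meromorphic function takes each value at isolated points, unless it is constant. -/
lemma eventually_ne_of_nonconst (hnc : ∃ z w, t z ≠ t w) (a : OnePoint ℂ) (τ : ℍ) :
    ∀ᶠ z in 𝓝[≠] τ, t z ≠ a := by
  by_cases ha : a = OnePoint.infty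
  · rw [ha]; exact ht.isolated_poles τ
  set F : ℂ → ℂ := fun z => finitePart t z - sphereToComplex a with hF
  have hm : MeromorphicOn F {z | 0 < z.im} := fun z hz =>
    (ht.meromorphicAt ⟨z, hz⟩).sub (MeromorphicAt.const _ _)
  -- Identity theorem: infinite order at one point spreads over the connected half-plane and makes
  -- `t` constant.
  by_cases htop : meromorphicOrderAt F τ = ⊤
  · exfalso
    have hall : ∀ w : ℍ, t w = a := by
      intro w
      have hw : meromorphicOrderAt F w = ⊤ := by
        by_contra hw
        exact hm.meromorphicOrderAt_ne_top_of_isPreconnected isPreconnected_upperHalfPlaneSet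
          w.im_pos τ.im_pos hw htop
      have h1 := eventually_nhdsNE_coe.1 (meromorphicOrderAt_eq_top_iff.1 hw)
      have h2 : ∀ᶠ z in 𝓝[≠] w, t z = a := by
        filter_upwards [h1, ht.isolated_poles w] with z hz hz'
        rw [hF] at hz
        simp only [finitePart_coe, sub_eq_zero] at hz
        exact sphereToComplex_injOn hz' ha hz
      exact tendsto_nhds_unique (ht.continuous.continuousAt.tendsto.mono_left nhdsWithin_le_nhds)
        (tendsto_const_nhds.congr' (h2.mono fun z hz => hz.symm))
    obtain ⟨z, w, hzw⟩ := hnc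
    exact hzw ((hall z).trans (hall w).symm)
  · have := eventually_nhdsNE_coe.1
      ((meromorphicOrderAt_ne_top_iff_eventually_ne_zero (hm τ τ.im_pos)).1 htop)
    filter_upwards [this] with z hz h
    apply hz
    simp [hF, finitePart_coe, h]

lemma eventually_localParam_ne_zero {τ : ℍ} (hne : ∀ᶠ z in 𝓝[≠] τ, t z ≠ t τ) :
    ∀ᶠ z in 𝓝[≠] (τ : ℂ), localParam t τ z ≠ 0 := by
  obtain ⟨V, hV, hinj⟩ := exists_injOn_sphereCoord (t τ)
  rw [eventually_nhdsNE_coe]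
  filter_upwards [hne, nhdsWithin_le_nhds (ht.continuous.continuousAt hV)] with z hz hzV h
  rw [localParam_coe, ← sphereCoord_self (t τ)] at h
  exact hz (hinj hzV (mem_of_mem_nhds hV) h)

/-- A nonconstant meromorphic function is an open map to the Riemann sphere. -/
lemma image_mem_nhds_sphere {τ : ℍ} (hne : ∀ᶠ z in 𝓝[≠] τ, t z ≠ t τ) {S : Set ℍ}
    (hS : S ∈ 𝓝 τ) : t '' S ∈ 𝓝 (t τ) := by
  obtain ⟨V, hV, hinj⟩ := exists_injOn_sphereCoord (t τ)
  have h0 : localParam t τ τ = 0 := by simp [localParam_coe]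
  have hopen : 𝓝 (0 : ℂ) ≤ map (localParam t τ) (𝓝 (τ : ℂ)) := by
    rcases (analyticAt_localParam ht τ).eventually_constant_or_nhds_le_map_nhds with h | h
    · exfalso
      have h1 := (eventually_localParam_ne_zero ht hne).and (nhdsWithin_le_nhds h)
      obtain ⟨z, hz, hz'⟩ := h1.exists
      exact hz (hz'.trans h0)
    · rwa [h0] at h
  have himg : (localParam t τ) '' (UpperHalfPlane.coe '' (S ∩ t ⁻¹' V)) ∈ 𝓝 (0 : ℂ) :=
    hopen (image_mem_map (isOpenEmbedding_coe.isOpenMap.image_mem_nhds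
      (inter_mem hS (ht.continuous.continuousAt hV))))
  have hc := continuousAt_sphereCoord (t τ)
  rw [ContinuousAt, sphereCoord_self] at hc
  filter_upwards [hc himg, hV] with x hx hxV
  obtain ⟨-, ⟨z, ⟨hzS, hzV⟩, rfl⟩, hzx⟩ := hx
  rw [localParam_coe] at hzx
  exact ⟨z, hzS, hinj hzV hxV hzx⟩

end

/-! ### Uniformizers of genus zero quotients -/

/-- An automorphic function `t` on `Γ` that separates the orbits of `Γ` and takes each value at
isolated points. -/
structure IsUniformizer (Γ : Subgroup SL(2, ℝ)) (t : ℍ → OnePoint ℂ) : Prop where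
  automorphic : IsAutomorphicFunction Γ t
  separates : ∀ z w, t z = t w → ∃ γ ∈ Γ, γ • z = w
  eventually_ne : ∀ (a : OnePoint ℂ) (τ : ℍ), ∀ᶠ z in 𝓝[≠] τ, t z ≠ a

/-- A Hauptmodul of a group of genus zero is a uniformizer. -/
theorem isUniformizer_of_isHauptmodul {Γ : Subgroup SL(2, ℝ)} {t : ℍ → OnePoint ℂ}
    (ht : IsHauptmodul Γ t) (hgenus : HasGenusZero Γ) : IsUniformizer Γ t := by
  obtain ⟨φ, hφ⟩ := hgenus
  set s : ℍ → OnePoint ℂ := fun τ => φ (Quotient.mk (MulAction.orbitRel Γ ℍ) τ) with hs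
  have hsinv : ∀ γ ∈ Γ, ∀ τ : ℍ, s (γ • τ) = s τ := by
    intro γ hγ τ
    exact congrArg φ (Quotient.sound ⟨⟨γ, hγ⟩, rfl⟩)
  have hsurj : ∀ x, ∃ τ, s τ = x := by
    intro x
    obtain ⟨q, hq⟩ := φ.surjective x
    induction q using Quotient.inductionOn with
    | h τ => exact ⟨τ, hq⟩
  obtain ⟨p, q, ⟨τ₀, hτ₀, hq₀⟩, hpq⟩ := ht.generates s ⟨hφ, hsinv⟩
  have htm := ht.automorphic.meromorphic
  have hnc : ∃ z w, t z ≠ t w := by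
    by_contra! hc
    obtain ⟨z, hz⟩ := hsurj ((0 : ℂ) : OnePoint ℂ)
    obtain ⟨w, hw⟩ := hsurj ((1 : ℂ) : OnePoint ℂ)
    have h1 := hpq z (by rw [hz]; simp) (by rwa [hc z τ₀])
    have h2 := hpq w (by rw [hw]; simp) (by rwa [hc w τ₀])
    rw [hz, hc z τ₀, sphereToComplex_coe, zero_mul] at h1
    rw [hw, hc w τ₀, sphereToComplex_coe, one_mul, ← h1] at h2
    exact hq₀ h2
  have hne := eventually_ne_of_nonconst htm hnc
  refine ⟨ht.automorphic, fun z w hzw => ?_, hne⟩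
  suffices hsw : s w = s z by
    obtain ⟨γ, hγ⟩ := Quotient.exact (φ.injective hsw)
    exact ⟨γ.1, γ.2, hγ⟩
  by_contra hsw
  -- The relation `s q(t) = p(t)` determines `s` from `t` outside finitely many values of `t`. Since
  -- `t` is open, neighbourhoods of `z` and `w` share a generic value `x` of `t`, at which `s` would
  -- lie in both `O₁` and `O₂`.
  obtain ⟨O₁, O₂, hO₁, hO₂, hz₁, hw₂, hdisj⟩ := t2_separation (Ne.symm hsw)
  have hnear : ∀ (v : ℍ) (O : Set (OnePoint ℂ)), IsOpen O → s v ∈ O →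
      {x | s x ∈ O ∧ (x ≠ v → s x ≠ OnePoint.infty)} ∈ 𝓝 v := fun v O hO hv =>
    inter_mem (hφ.continuous.continuousAt (hO.mem_nhds hv))
      (eventually_nhdsWithin_iff.1 (hφ.isolated_poles v))
  have himz := image_mem_nhds_sphere htm (hne _ z) (hnear z O₁ hO₁ hz₁)
  have himw := image_mem_nhds_sphere htm (hne _ w) (hnear w O₂ hO₂ hw₂)
  rw [← hzw] at himw
  have hq : q ≠ 0 := by rintro rfl; simp at hq₀
  have hfin : ({OnePoint.infty} ∪ ((↑) : ℂ → OnePoint ℂ) '' (q.rootSet ℂ)).Finite :=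
    (finite_singleton _).union ((q.rootSet_finite ℂ).image _)
  have hgood : ∀ᶠ x in 𝓝[≠] (t z),
      x ∉ ({OnePoint.infty} ∪ ((↑) : ℂ → OnePoint ℂ) '' (q.rootSet ℂ)) := by
    have := (hfin.subset (sdiff_subset (t := {t z}))).isClosed.isOpen_compl.mem_nhds
      (x := t z) (by simp)
    filter_upwards [nhdsWithin_le_nhds this, self_mem_nhdsWithin] with x hx hx' hx''
    exact hx ⟨hx'', hx'⟩
  have hmem : ∀ᶠ x in 𝓝[≠] (t z), x ∈ t '' {x | s x ∈ O₁ ∧ (x ≠ z → s x ≠ OnePoint.infty)} ∩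
      t '' {x | s x ∈ O₂ ∧ (x ≠ w → s x ≠ OnePoint.infty)} :=
    nhdsWithin_le_nhds (inter_mem himz himw)
  obtain ⟨x, ⟨⟨⟨z', ⟨hz'O, hz'i⟩, hz't⟩, ⟨w', ⟨hw'O, hw'i⟩, hw't⟩⟩, hxgood⟩, hxne⟩ :=
    ((hmem.and hgood).and self_mem_nhdsWithin).exists
  have hxi : x ≠ OnePoint.infty := fun h => hxgood (Or.inl h)
  have hqx : q.eval (sphereToComplex x) ≠ 0 := by
    intro h
    refine hxgood (Or.inr ⟨sphereToComplex x, ?_, coe_sphereToComplex hxi⟩)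
    rw [Polynomial.mem_rootSet]
    exact ⟨hq, by simpa using h⟩
  have hz'z : z' ≠ z := by rintro rfl; exact hxne hz't.symm
  have hw'w : w' ≠ w := by rintro rfl; exact hxne (hw't.symm.trans hzw.symm)
  have h1 := hpq z' (hz'i hz'z) (by rwa [hz't])
  have h2 := hpq w' (hw'i hw'w) (by rwa [hw't])
  rw [hz't] at h1
  rw [hw't, ← h1] at h2
  have h3 := sphereToComplex_injOn (hw'i hw'w) (hz'i hz'z) (mul_right_cancel₀ hqx h2)
  exact disjoint_left.1 hdisj hz'O (h3 ▸ hw'O)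

section

variable {Γ : Subgroup SL(2, ℝ)} {t : ℍ → OnePoint ℂ} (ht : IsUniformizer Γ t)

include ht

lemma eq_iff_equivalent (z w : ℍ) : t z = t w ↔ ∃ γ ∈ Γ, γ • z = w := by
  refine ⟨ht.separates z w, ?_⟩
  rintro ⟨γ, hγ, rfl⟩
  exact (ht.automorphic.invariant γ hγ z).symm

lemma exists_localParam_eq_iff (τ : ℍ) :
    ∃ U ∈ 𝓝 τ, ∀ z ∈ U, ∀ w ∈ U, localParam t τ z = localParam t τ w ↔ t z = t w := by
  obtain ⟨V, hV, hinj⟩ := exists_injOn_sphereCoord (t τ)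
  refine ⟨t ⁻¹' V, ht.automorphic.meromorphic.continuous.continuousAt hV, fun z hz w hw => ?_⟩
  rw [localParam_coe, localParam_coe]
  exact hinj.eq_iff hz hw

/-- The ramification index of a uniformizer is the order of the stabilizer. -/
theorem analyticOrderAt_localParam (τ : ℍ) :
    stabilizerOrder Γ τ ≠ 0 ∧ analyticOrderAt (localParam t τ) τ = stabilizerOrder Γ τ := by
  have hm := ht.automorphic.meromorphic
  have ha := analyticAt_localParam hm τ
  have htop : analyticOrderAt (localParam t τ) τ ≠ ⊤ := by
    intro h
    rw [analyticOrderAt_eq_top] at h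
    obtain ⟨z, hz, hz'⟩ := ((eventually_localParam_ne_zero hm (ht.eventually_ne _ τ)).and
      (nhdsWithin_le_nhds h)).exists
    exact hz hz'
  obtain ⟨n, hn⟩ := ENat.ne_top_iff_exists.1 htop
  have hn0 : n ≠ 0 := by
    rintro rfl
    have := ha.analyticOrderAt_eq_zero.1 hn.symm
    simp [localParam_coe] at this
  obtain ⟨U, hU, hfib⟩ := exists_localParam_eq_iff ht τ
  have := stabilizerOrder_eq_of_fibres Γ hn0 ha hn.symm hU fun z hz w hw =>
    (hfib z hz w hw).trans (eq_iff_equivalent ht z w)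
  rw [this]
  exact ⟨hn0, hn.symm⟩

lemma meromorphicOrderAt_sub_of_ne_infty {τ : ℍ} (h : t τ ≠ OnePoint.infty) :
    meromorphicOrderAt (fun z => finitePart t z - sphereToComplex (t τ)) τ =
      ((stabilizerOrder Γ τ : ℤ) : WithTop ℤ) := by
  rw [← localParam_of_ne_infty h,
    (analyticAt_localParam ht.automorphic.meromorphic τ).meromorphicOrderAt_eq,
    (analyticOrderAt_localParam ht τ).2]
  rfl

lemma meromorphicOrderAt_of_infty {τ : ℍ} (h : t τ = OnePoint.infty) :
    meromorphicOrderAt (finitePart t) τ = ((-(stabilizerOrder Γ τ : ℤ) : ℤ) : WithTop ℤ) := by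
  have h1 := (analyticAt_localParam ht.automorphic.meromorphic τ).meromorphicOrderAt_eq
  rw [(analyticOrderAt_localParam ht τ).2, localParam_of_infty h, meromorphicOrderAt_inv] at h1
  rw [← neg_neg (meromorphicOrderAt _ _), h1]
  rfl

/-- The order of a `Γ`-invariant meromorphic function at `τ` is divisible by the order of the
stabilizer of `τ`. -/
theorem stabilizerOrder_dvd_order {F : ℂ → ℂ} {τ : ℍ} (hF : MeromorphicAt F τ)
    (hinv : ∀ γ ∈ Γ, ∀ z : ℍ, t z ≠ OnePoint.infty → F ((γ • z : ℍ) : ℂ) = F z) {N : ℤ}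
    (hN : meromorphicOrderAt F τ = N) : (stabilizerOrder Γ τ : ℤ) ∣ N := by
  obtain ⟨h0, ho⟩ := analyticOrderAt_localParam ht τ
  obtain ⟨U, hU, hfib⟩ := exists_localParam_eq_iff ht τ
  have hW : U ∩ {z | t z ≠ OnePoint.infty} ∈ 𝓝[≠] τ :=
    inter_mem (nhdsWithin_le_nhds hU) (ht.eventually_ne _ τ)
  refine dvd_order_of_factors h0 (analyticAt_localParam ht.automorphic.meromorphic τ) ho
    (U := UpperHalfPlane.coe '' (U ∩ {z | t z ≠ OnePoint.infty})) ?_ ?_ hF hN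
  · rw [← map_coe_nhdsNE]
    exact image_mem_map hW
  · rintro - ⟨z, ⟨hz, hz'⟩, rfl⟩ - ⟨w, ⟨hw, -⟩, rfl⟩ hzw
    obtain ⟨γ, hγ, rfl⟩ := ht.separates z w ((hfib z hz w hw).1 hzw)
    exact (hinv γ hγ z hz').symm

end

/-! ### The form `t' ^ m * ∏ (t - a i) ^ (-c i)` -/

/-- The meromorphic form `t' ^ m * ∏ (t - t (p i)) ^ (-c i)` of weight `2m`, the product being over
the indices with `t (p i)` finite. -/
def baseForm [DecidableEq (OnePoint ℂ)] (t : ℍ → OnePoint ℂ) {r : ℕ} (p : Fin r → ℍ) (m : ℕ)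
    (c : Fin r → ℤ) (z : ℂ) : ℂ :=
  deriv (finitePart t) z ^ m * ∏ i with t (p i) ≠ OnePoint.infty,
    (finitePart t z - sphereToComplex (t (p i))) ^ (-c i)

section

variable {Γ : Subgroup SL(2, ℝ)} {t : ℍ → OnePoint ℂ} (ht : IsUniformizer Γ t)

include ht

lemma finitePart_smul {γ : SL(2, ℝ)} (hγ : γ ∈ Γ) (z : ℍ) :
    finitePart t ((γ • z : ℍ) : ℂ) = finitePart t z := by
  rw [finitePart_coe, finitePart_coe, ht.automorphic.invariant γ hγ]

lemma deriv_finitePart_smul {γ : SL(2, ℝ)} (hγ : γ ∈ Γ) {z : ℍ} (hz : t z ≠ OnePoint.infty) :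
    deriv (finitePart t) ((γ • z : ℍ) : ℂ) = autFactor γ z ^ 2 * deriv (finitePart t) z := by
  have hz' : t (γ • z) ≠ OnePoint.infty := by rwa [ht.automorphic.invariant γ hγ]
  have h1 := (analyticAt_finitePart ht.automorphic.meromorphic hz').differentiableAt.hasDerivAt
  have h2 : HasDerivAt (finitePart t ∘ fun w : ℂ => ((γ • ofComplex w : ℍ) : ℂ))
      (deriv (finitePart t) ((γ • z : ℍ) : ℂ) * (1 / autFactor γ z ^ 2)) z := by
    refine HasDerivAt.comp (z : ℂ) ?_ (hasDerivAt_smul γ z)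
    rwa [ofComplex_apply]
  have h3 : (finitePart t ∘ fun w : ℂ => ((γ • ofComplex w : ℍ) : ℂ)) = finitePart t := by
    funext w
    rw [Function.comp_apply, finitePart_smul ht hγ]
    simp [finitePart, ofComplex_apply]
  rw [h3] at h2
  have := autFactor_ne_zero γ z
  rw [h2.deriv]
  field_simp

lemma meromorphicAt_finitePart (τ : ℍ) : MeromorphicAt (finitePart t) τ :=
  ht.automorphic.meromorphic.meromorphicAt τ

lemma meromorphicOrderAt_deriv_finitePart (τ : ℍ) [Decidable (t τ = OnePoint.infty)] :
    meromorphicOrderAt (deriv (finitePart t)) τ =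
      (((if t τ = OnePoint.infty then -1 else 1) * (stabilizerOrder Γ τ : ℤ) - 1 : ℤ) :
        WithTop ℤ) := by
  have he := (analyticOrderAt_localParam ht τ).1
  split_ifs with h
  · rw [neg_one_mul]
    exact meromorphicOrderAt_deriv_eq_sub_one (by simpa using he) (meromorphicOrderAt_of_infty ht h)
  · have := meromorphicOrderAt_deriv_eq_sub_one (by simpa using he)
      (meromorphicOrderAt_sub_of_ne_infty ht h)
    rw [one_mul, ← this]
    congr 1
    funext z
    rw [deriv_sub_const]

variable [DecidableEq (OnePoint ℂ)]

lemma meromorphicOrderAt_finitePart_sub (τ q : ℍ) (hq : t q ≠ OnePoint.infty) :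
    meromorphicOrderAt (fun z => finitePart t z - sphereToComplex (t q)) τ =
      (((stabilizerOrder Γ τ : ℤ) *
        (if t τ = OnePoint.infty then -1 else if t q = t τ then 1 else 0) : ℤ) : WithTop ℤ) := by
  have he := (analyticOrderAt_localParam ht τ).1
  split_ifs with h h'
  · have h1 := meromorphicOrderAt_of_infty ht h
    have h2 : (0 : WithTop ℤ) ≤ meromorphicOrderAt (fun _ : ℂ => -sphereToComplex (t q)) τ :=
      analyticAt_const.meromorphicOrderAt_nonneg
    have h3 : meromorphicOrderAt (finitePart t + fun _ : ℂ => -sphereToComplex (t q)) τ =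
        meromorphicOrderAt (finitePart t) τ := by
      refine meromorphicOrderAt_add_eq_left_of_lt (MeromorphicAt.const _ _) (lt_of_lt_of_le ?_ h2)
      rw [h1]
      exact_mod_cast (by omega : -(stabilizerOrder Γ τ : ℤ) < 0)
    rw [mul_neg_one, ← h1, ← h3]
    rfl
  · rw [mul_one, h', meromorphicOrderAt_sub_of_ne_infty ht h]
  · rw [mul_zero]
    refine (tendsto_ne_zero_iff_meromorphicOrderAt_eq_zero
      ((meromorphicAt_finitePart ht τ).sub (MeromorphicAt.const _ _))).1
      ⟨sphereToComplex (t τ) - sphereToComplex (t q), ?_, ?_⟩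
    · rw [sub_ne_zero]
      exact fun h'' => h' (sphereToComplex_injOn h hq h'').symm
    · have := (analyticAt_finitePart ht.automorphic.meromorphic h).continuousAt.tendsto
      rw [finitePart_coe] at this
      exact (this.mono_left nhdsWithin_le_nhds).sub_const _

variable {r : ℕ} (p : Fin r → ℍ) (m : ℕ) (c : Fin r → ℤ)

lemma baseForm_smul {γ : SL(2, ℝ)} (hγ : γ ∈ Γ) {z : ℍ} (hz : t z ≠ OnePoint.infty) :
    baseForm t p m c ((γ • z : ℍ) : ℂ) = autFactor γ z ^ (2 * m) * baseForm t p m c z := by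
  simp only [baseForm, finitePart_smul ht hγ, deriv_finitePart_smul ht hγ hz]
  ring

lemma meromorphicAt_baseForm (τ : ℍ) : MeromorphicAt (baseForm t p m c) τ := by
  refine ((meromorphicAt_finitePart ht τ).deriv.pow m).mul (MeromorphicAt.fun_prod fun i _ => ?_)
  exact ((meromorphicAt_finitePart ht τ).sub (MeromorphicAt.const _ _)).zpow _

/-- The order of `baseForm` at a point. -/
theorem meromorphicOrderAt_baseForm (τ : ℍ) :
    meromorphicOrderAt (baseForm t p m c) τ =
      ((m * ((stabilizerOrder Γ τ : ℤ) - 1) -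
        (stabilizerOrder Γ τ : ℤ) * (∑ i with t (p i) = t τ, c i) +
        (if t τ = OnePoint.infty then (stabilizerOrder Γ τ : ℤ) * (∑ i, c i - 2 * m) else 0) : ℤ) :
        WithTop ℤ) := by
  have hT := meromorphicAt_finitePart ht τ
  have hsub : ∀ i, MeromorphicAt (fun z => finitePart t z - sphereToComplex (t (p i))) τ :=
    fun i => hT.sub (MeromorphicAt.const _ _)
  have h1 : meromorphicOrderAt (fun z => ∏ i with t (p i) ≠ OnePoint.infty,
      (finitePart t z - sphereToComplex (t (p i))) ^ (-c i)) τ =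
      ((∑ i with t (p i) ≠ OnePoint.infty, -c i * ((stabilizerOrder Γ τ : ℤ) *
        (if t τ = OnePoint.infty then -1 else if t (p i) = t τ then 1 else 0)) : ℤ) :
        WithTop ℤ) := by
    rw [meromorphicOrderAt_fun_prod fun i _ => (hsub i).fun_zpow _, WithTop.coe_sum]
    refine Finset.sum_congr rfl fun i hi => ?_
    rw [fun_meromorphicOrderAt_zpow (hsub i),
      meromorphicOrderAt_finitePart_sub ht τ (p i) (Finset.mem_filter.1 hi).2, ← WithTop.coe_mul]
  have h2 : meromorphicOrderAt (fun z => deriv (finitePart t) z ^ m) τ =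
      ((m * ((if t τ = OnePoint.infty then -1 else 1) * (stabilizerOrder Γ τ : ℤ) - 1) : ℤ) :
        WithTop ℤ) := by
    rw [fun_meromorphicOrderAt_pow hT.deriv, meromorphicOrderAt_deriv_finitePart ht τ,
      WithTop.coe_mul]
    rfl
  have h3 := fun_meromorphicOrderAt_mul (hT.deriv.fun_pow m)
    (MeromorphicAt.fun_prod (s := Finset.univ.filter fun i => t (p i) ≠ OnePoint.infty)
      fun i _ => (hsub i).fun_zpow (-c i))
  rw [h1, h2, ← WithTop.coe_add] at h3
  refine h3.trans (congrArg _ ?_)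
  split_ifs with h
  -- At a pole of `t` every factor of the product has a pole, while indices with `t (p i) = ∞` are
  -- absent from it; splitting the total sum of `c` restores the uniform formula.
  · have h4 := Finset.sum_filter_add_sum_filter_not Finset.univ
      (fun i => t (p i) = OnePoint.infty) c
    rw [h, ← h4]
    simp only [mul_neg, neg_mul, mul_one, neg_neg, ← Finset.sum_mul]
    ring
  · have h4 : ∑ i with t (p i) ≠ OnePoint.infty,
        -c i * ((stabilizerOrder Γ τ : ℤ) * (if t (p i) = t τ then 1 else 0)) =
        -(stabilizerOrder Γ τ : ℤ) * ∑ i with t (p i) = t τ, c i := by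
      rw [Finset.mul_sum, Finset.sum_filter, Finset.sum_filter]
      refine Finset.sum_congr rfl fun i _ => ?_
      by_cases h5 : t (p i) = t τ
      · simp only [h5, h, ne_eq, not_false_eq_true, if_true]; ring
      · simp [h5]
    rw [h4]
    ring

end

/-! ### Holomorphic extension -/

lemma eq_of_eventually_eq_nhdsNE {f g : ℍ → ℂ} {τ : ℍ} (hf : ContinuousAt f τ)
    (hg : ContinuousAt g τ) (h : ∀ᶠ z in 𝓝[≠] τ, f z = g z) : f τ = g τ :=
  tendsto_nhds_unique (hf.tendsto.mono_left nhdsWithin_le_nhds)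
    ((hg.tendsto.mono_left nhdsWithin_le_nhds).congr' (h.mono fun _ hz => hz.symm))

/-- The last clause keeps the values of `f` wherever it is already analytic, so that the basis can
be given by its explicit formula there. -/
lemma exists_holomorphic_extension {f : ℂ → ℂ} (hm : ∀ τ : ℍ, MeromorphicAt f τ)
    (ho : ∀ τ : ℍ, 0 ≤ meromorphicOrderAt f τ) :
    ∃ g : ℍ → ℂ, MDifferentiable 𝓘(ℂ) 𝓘(ℂ) g ∧ (∀ τ : ℍ, ∀ᶠ z in 𝓝[≠] τ, g z = f z) ∧
      ∀ τ : ℍ, AnalyticAt ℂ f τ → g τ = f τ := by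
  have hm' : MeromorphicOn f {z | 0 < z.im} := fun z hz => hm ⟨z, hz⟩
  set G := toMeromorphicNFOn f {z : ℂ | 0 < z.im} with hG
  have hGa : ∀ τ : ℍ, AnalyticAt ℂ G τ := by
    intro τ
    have h1 : MeromorphicNFAt G τ := meromorphicNFOn_toMeromorphicNFOn f _ τ.im_pos
    rw [← h1.meromorphicOrderAt_nonneg_iff_analyticAt, hG,
      meromorphicOrderAt_toMeromorphicNFOn hm' τ.im_pos]
    exact ho τ
  have hGf : ∀ τ : ℍ, ∀ᶠ z : ℍ in 𝓝[≠] τ, G (z : ℂ) = f z := fun τ =>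
    eventually_nhdsNE_coe.1 (hm'.toMeromorphicNFOn_eq_self_on_nhdsNE τ.im_pos)
  refine ⟨fun τ => G τ, ?_, hGf, fun τ hτ => ?_⟩
  · rw [UpperHalfPlane.mdifferentiable_iff]
    have h1 : DifferentiableOn ℂ G {z | 0 < z.im} := fun z hz =>
      (hGa ⟨z, hz⟩).differentiableAt.differentiableWithinAt
    refine h1.congr fun z hz => ?_
    simp [ofComplex_apply_of_im_pos hz]
  · exact eq_of_eventually_eq_nhdsNE (f := fun z : ℍ => G z) (g := fun z : ℍ => f z)
      ((hGa τ).continuousAt.comp continuous_coe.continuousAt)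
      (hτ.continuousAt.comp continuous_coe.continuousAt) (hGf τ)

section

variable {Γ : Subgroup SL(2, ℝ)} {t : ℍ → OnePoint ℂ} (ht : IsUniformizer Γ t)

include ht

/-- At poles of `t` the function `f` may have junk values, so its transformation law is assumed only
elsewhere; continuity of `g` fills in the isolated exceptions. -/
lemma extension_smul {f : ℂ → ℂ} {g : ℍ → ℂ} (hg : Continuous g)
    (hgf : ∀ τ : ℍ, ∀ᶠ z in 𝓝[≠] τ, g z = f z) {γ : SL(2, ℝ)} {j : ℍ → ℂ} (hj : Continuous j)
    (hf : ∀ z : ℍ, t z ≠ OnePoint.infty → f ((γ • z : ℍ) : ℂ) = j z * f z) (τ : ℍ) :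
    g (γ • τ) = j τ * g τ := by
  refine eq_of_eventually_eq_nhdsNE (f := fun z => g (γ • z)) (g := fun z => j z * g z)
    (hg.comp (continuous_smul_const γ)).continuousAt (hj.mul hg).continuousAt ?_
  filter_upwards [hgf τ, (tendsto_smul_nhdsNE γ τ).eventually (hgf (γ • τ)),
    ht.eventually_ne OnePoint.infty τ] with z h1 h2 h3
  rw [h1, h2, hf z h3]

/-- A uniformizer of a compact quotient takes the value `∞`. -/
lemma exists_eq_infty [CompactSpace (MulAction.orbitRel.Quotient Γ ℍ)] :
    ∃ τ, t τ = OnePoint.infty := by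
  by_contra! h
  obtain ⟨c, hc⟩ := eq_const_of_weight_zero Γ (g := fun z => sphereToComplex (t z))
    (by
      rw [UpperHalfPlane.mdifferentiable_iff]
      exact fun z hz => (analyticAt_finitePart ht.automorphic.meromorphic
        (h ⟨z, hz⟩)).differentiableAt.differentiableWithinAt)
    (fun γ hγ z => by rw [ht.automorphic.invariant γ hγ])
  obtain ⟨z, hz⟩ := (ht.eventually_ne (c : OnePoint ℂ) I).exists
  exact hz (by rw [← hc z, coe_sphereToComplex (h z)])

/-- A `Γ`-invariant meromorphic function whose only poles are those of `t`, of order less than that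
of `t ^ d`, is a polynomial in `t` of degree less than `d`. -/
theorem exists_eq_sum_pow [CompactSpace (MulAction.orbitRel.Quotient Γ ℍ)] (d : ℕ) {F : ℂ → ℂ}
    (hF : ∀ τ : ℍ, MeromorphicAt F τ)
    (hinv : ∀ γ ∈ Γ, ∀ z : ℍ, t z ≠ OnePoint.infty → F ((γ • z : ℍ) : ℂ) = F z)
    (hfin : ∀ τ : ℍ, t τ ≠ OnePoint.infty → 0 ≤ meromorphicOrderAt F τ)
    (hinf : ∀ τ : ℍ, t τ = OnePoint.infty →
      ((-(stabilizerOrder Γ τ * ((d : ℤ) - 1)) : ℤ) : WithTop ℤ) ≤ meromorphicOrderAt F τ) :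
    ∃ a : Fin d → ℂ, ∀ τ : ℍ, ∀ᶠ z : ℍ in 𝓝[≠] τ,
      F z = ∑ j, a j * finitePart t z ^ (j : ℕ) := by
  obtain ⟨τ₀, hτ₀⟩ := exists_eq_infty ht
  induction d generalizing F with
  | zero =>
    -- For `d = 0` the bound at the poles of `t` is positive: `F` vanishes there, and being constant
    -- it is zero.
    have hpos : ∀ τ : ℍ, t τ = OnePoint.infty → 0 < meromorphicOrderAt F τ := by
      intro τ hτ
      refine lt_of_lt_of_le ?_ (hinf τ hτ)
      have := (analyticOrderAt_localParam ht τ).1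
      exact_mod_cast (by push_cast; omega :
        (0 : ℤ) < -(stabilizerOrder Γ τ * (((0 : ℕ) : ℤ) - 1)))
    obtain ⟨g, hg, hgF, -⟩ := exists_holomorphic_extension hF fun τ => by
      by_cases h : t τ = OnePoint.infty
      · exact (hpos τ h).le
      · exact hfin τ h
    obtain ⟨c, hc⟩ := eq_const_of_weight_zero Γ hg fun γ hγ z => by
      simpa using extension_smul ht hg.continuous hgF (j := fun _ => 1) continuous_const
        (fun z hz => by rw [one_mul]; exact hinv γ hγ z hz) z
    have hlim := tendsto_nhdsNE_coe.1
      ((tendsto_zero_iff_meromorphicOrderAt_pos (hF τ₀)).2 (hpos τ₀ hτ₀))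
    have hc0 : c = 0 := by
      refine tendsto_nhds_unique (tendsto_const_nhds.congr' ?_) hlim
      filter_upwards [hgF τ₀] with z hz
      rw [← hz, hc]
    refine ⟨Fin.elim0, fun τ => ?_⟩
    filter_upwards [hgF τ] with z hz
    simp [← hz, hc, hc0]
  | succ d ih =>
    have hT := meromorphicAt_finitePart ht
    have hTinv : ∀ τ : ℍ, t τ = OnePoint.infty →
        meromorphicOrderAt (fun z => (finitePart t z)⁻¹ ^ d) τ =
          ((stabilizerOrder Γ τ * d : ℤ) : WithTop ℤ) := by
      intro τ hτ
      rw [fun_meromorphicOrderAt_pow (hT τ).fun_inv, fun_meromorphicOrderAt_inv,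
        meromorphicOrderAt_of_infty ht hτ]
      exact_mod_cast (by ring :
        (d : ℤ) * -(-(stabilizerOrder Γ τ : ℤ)) = stabilizerOrder Γ τ * d)
    have hTm : ∀ τ : ℍ, MeromorphicAt (fun z => (finitePart t z)⁻¹ ^ d) τ := fun τ =>
      ((hT τ).inv).pow d
    have hnonneg : 0 ≤ meromorphicOrderAt (fun z => F z * (finitePart t z)⁻¹ ^ d) τ₀ := by
      rw [fun_meromorphicOrderAt_mul (hF τ₀) (hTm τ₀), hTinv τ₀ hτ₀]
      refine le_trans ?_ (add_le_add_left (hinf τ₀ hτ₀) _)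
      rw [← WithTop.coe_add]
      exact_mod_cast (by push_cast; linarith : (0 : ℤ) ≤
        -(stabilizerOrder Γ τ₀ * (((d + 1 : ℕ) : ℤ) - 1)) + stabilizerOrder Γ τ₀ * d)
    obtain ⟨a, ha⟩ := tendsto_nhds_of_meromorphicOrderAt_nonneg ((hF τ₀).mul (hTm τ₀)) hnonneg
    have ha := tendsto_nhdsNE_coe.1 ha
    -- The poles of `t` form a single orbit, so one coefficient `a` cancels the leading term at all
    -- of them.
    have hlim : ∀ τ : ℍ, t τ = OnePoint.infty →
        Tendsto (fun z : ℍ => F z * (finitePart t z)⁻¹ ^ d) (𝓝[≠] τ) (𝓝 a) := by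
      intro τ hτ
      obtain ⟨γ, hγ, hγτ⟩ := ht.separates τ τ₀ (hτ.trans hτ₀.symm)
      have h1 := tendsto_smul_nhdsNE γ τ
      rw [hγτ] at h1
      refine (ha.comp h1).congr' ?_
      filter_upwards [ht.eventually_ne OnePoint.infty τ] with z hz
      simp only [Function.comp_apply, Pi.mul_apply, hinv γ hγ z hz, finitePart_smul ht hγ]
    set F' : ℂ → ℂ := fun z => F z + -a * finitePart t z ^ d with hF'
    have hpm : ∀ τ : ℍ, MeromorphicAt (fun z => -a * finitePart t z ^ d) τ := fun τ =>
      (MeromorphicAt.const _ _).mul ((hT τ).pow d)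
    have hFm' : ∀ τ : ℍ, MeromorphicAt F' τ := fun τ => (hF τ).add (hpm τ)
    have hinv' : ∀ γ ∈ Γ, ∀ z : ℍ, t z ≠ OnePoint.infty → F' ((γ • z : ℍ) : ℂ) = F' z := by
      intro γ hγ z hz
      simp only [hF', hinv γ hγ z hz, finitePart_smul ht hγ]
    have hfin' : ∀ τ : ℍ, t τ ≠ OnePoint.infty → 0 ≤ meromorphicOrderAt F' τ := by
      intro τ hτ
      refine le_trans (le_min (hfin τ hτ) ?_) (meromorphicOrderAt_add (hF τ) (hpm τ))
      exact (analyticAt_const.mul ((analyticAt_finitePart ht.automorphic.meromorphic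
        hτ).pow d)).meromorphicOrderAt_nonneg
    have hinf' : ∀ τ : ℍ, t τ = OnePoint.infty →
        ((-(stabilizerOrder Γ τ * ((d : ℤ) - 1)) : ℤ) : WithTop ℤ) ≤ meromorphicOrderAt F' τ := by
      intro τ hτ
      by_cases htop : meromorphicOrderAt F' τ = ⊤
      · rw [htop]; exact le_top
      obtain ⟨N, hN⟩ := WithTop.ne_top_iff_exists.1 htop
      have hpos : 0 < meromorphicOrderAt (fun z => F' z * (finitePart t z)⁻¹ ^ d) τ := by
        rw [← tendsto_zero_iff_meromorphicOrderAt_pos ((hFm' τ).fun_mul (hTm τ)), tendsto_nhdsNE_coe,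
          ← add_neg_cancel a]
        refine ((hlim τ hτ).add_const (-a)).congr' ?_
        have hne := ht.eventually_ne ((0 : ℂ) : OnePoint ℂ) τ
        filter_upwards [hne, ht.eventually_ne OnePoint.infty τ] with z hz hz'
        have hz0 : finitePart t z ≠ 0 := by
          rw [finitePart_coe]
          intro h
          exact hz (by rw [← h, coe_sphereToComplex hz'])
        simp only [hF']
        rw [add_mul, mul_assoc, ← mul_pow, mul_inv_cancel₀ hz0, one_pow, mul_one]
      rw [fun_meromorphicOrderAt_mul (hFm' τ) (hTm τ), hTinv τ hτ, ← hN, ← WithTop.coe_add] at hpos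
      have hpos : (0 : ℤ) < N + stabilizerOrder Γ τ * d := by exact_mod_cast hpos
      -- Cancellation only gives order greater than `-e d`; divisibility by `e` improves this to at
      -- least `-e (d - 1)`.
      obtain ⟨q, rfl⟩ := stabilizerOrder_dvd_order ht (hFm' τ) hinv' hN.symm
      rw [← hN]
      have he : (0 : ℤ) < stabilizerOrder Γ τ := by
        have := (analyticOrderAt_localParam ht τ).1
        omega
      rw [← mul_add] at hpos
      have hq : 0 < q + d := pos_of_mul_pos_right hpos he.le
      refine WithTop.coe_le_coe.2 ?_
      nlinarith
    obtain ⟨b, hb⟩ := ih hFm' hinv' hfin' hinf'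
    refine ⟨Fin.snoc b a, fun τ => ?_⟩
    filter_upwards [hb τ] with z hz
    rw [Fin.sum_univ_castSucc]
    simp only [Fin.snoc_castSucc, Fin.snoc_last, Fin.val_castSucc, Fin.val_last, ← hz, hF']
    ring

/-! ### Elliptic points -/

/-- Both sides are ramification indices of `t`, and these agree along an orbit because `t` is
invariant and `γ` is locally biholomorphic. -/
lemma stabilizerOrder_congr {τ q : ℍ} (h : t q = t τ) :
    stabilizerOrder Γ τ = stabilizerOrder Γ q := by
  obtain ⟨γ, hγ, rfl⟩ := ht.separates q τ h
  have h1 := meromorphicOrderAt_comp_smul (f := fun z => sphereCoord (t q) (t z)) (τ := q)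
    (det_toGL_pos γ)
  have h2 : ∀ z : ℍ, t ((Matrix.SpecialLinearGroup.mapGL ℝ γ : GL (Fin 2) ℝ) • z) = t z :=
    ht.automorphic.invariant γ hγ
  have h3 : ∀ τ : ℍ, meromorphicOrderAt (localParam t τ) τ =
      ((stabilizerOrder Γ τ : ℤ) : WithTop ℤ) := by
    intro τ
    rw [(analyticAt_localParam ht.automorphic.meromorphic τ).meromorphicOrderAt_eq,
      (analyticOrderAt_localParam ht τ).2]
    rfl
  simp only [h2] at h1
  have h4 : meromorphicOrderAt (localParam t q) q =
      meromorphicOrderAt (localParam t (γ • q)) ((γ • q : ℍ) : ℂ) := by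
    unfold localParam
    rw [← h]
    exact h1
  rw [h3, h3] at h4
  exact_mod_cast h4.symm

variable {r : ℕ} {p : Fin r → ℍ} {e : Fin r → ℕ} (hell : AreEllipticPoints Γ p e)

include hell

lemma stabilizerOrder_eq_one_or (τ : ℍ) :
    (stabilizerOrder Γ τ = 1 ∧ ∀ i, t (p i) ≠ t τ) ∨
      ∃ i, stabilizerOrder Γ τ = e i ∧ ∀ j, t (p j) = t τ ↔ j = i := by
  by_cases h : ∃ i, t (p i) = t τ
  · obtain ⟨i, hi⟩ := h
    refine Or.inr ⟨i, (stabilizerOrder_congr ht hi).trans (hell.order_eq i), fun j => ⟨fun hj => ?_,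
      fun hj => hj ▸ hi⟩⟩
    exact hell.inequivalent j i (ht.separates _ _ (hj.trans hi.symm))
  · push Not at h
    refine Or.inl ⟨?_, h⟩
    by_contra hne
    obtain ⟨i, γ, hγ, hi⟩ := hell.exhaustive τ hne
    exact h i (by rw [← hi, ht.automorphic.invariant γ hγ])

/-- The condition `φ 1 = 0` covers the non-elliptic points, whose sum is empty. -/
lemma sum_fibre_eq [DecidableEq (OnePoint ℂ)] (φ : ℕ → ℤ) (hφ : φ 1 = 0) (τ : ℍ) :
    ∑ i with t (p i) = t τ, φ (e i) = φ (stabilizerOrder Γ τ) := by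
  rcases stabilizerOrder_eq_one_or ht hell τ with ⟨h1, h2⟩ | ⟨i, h1, h2⟩
  · rw [h1, hφ, Finset.filter_false_of_mem fun i _ => h2 i, Finset.sum_empty]
  · rw [h1]
    simp only [h2]
    rw [Finset.sum_filter, Finset.sum_ite_eq' Finset.univ i]
    simp

/-- The Gauss–Bonnet inequality for a compact quotient of genus zero. -/
theorem two_lt_sum [CompactSpace (MulAction.orbitRel.Quotient Γ ℍ)] :
    (2 : ℚ) < ∑ i, (1 - 1 / (e i : ℚ)) := by
  classical
  by_contra! hle
  -- As `N` is divisible by every `e i`, the exponents `N (1 - 1/e i)` are integers. The form then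
  -- has order exactly zero where `t` is finite, and order `e (∑ φ (e i) - 2N) ≤ 0` over `∞`, so its
  -- inverse is holomorphic of weight `-2N`.
  set N : ℕ := ∏ i, e i with hN
  have hepos : ∀ i, 0 < e i := fun i => by have := hell.one_lt i; omega
  have hNpos : 0 < N := Finset.prod_pos fun i _ => hepos i
  set φ : ℕ → ℤ := fun n => (N : ℤ) - (N : ℤ) / n with hφ
  set f := baseForm t p N fun i => φ (e i) with hf
  have hdvd : ∀ i, e i ∣ N := fun i => Finset.dvd_prod_of_mem e (Finset.mem_univ i)
  have hdvd' : ∀ τ, stabilizerOrder Γ τ ∣ N := by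
    intro τ
    rcases stabilizerOrder_eq_one_or ht hell τ with ⟨h1, -⟩ | ⟨i, h1, -⟩
    · rw [h1]; exact one_dvd _
    · rw [h1]; exact hdvd i
  have hsum : ∑ i, φ (e i) - 2 * N ≤ 0 := by
    have h1 : ∀ i, ((φ (e i) : ℤ) : ℚ) = N * (1 - 1 / (e i : ℚ)) := by
      intro i
      obtain ⟨q, hq⟩ := hdvd i
      have he : (e i : ℚ) ≠ 0 := by exact_mod_cast (hepos i).ne'
      have he' : (e i : ℤ) ≠ 0 := by exact_mod_cast (hepos i).ne'
      simp only [hφ, hq]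
      push_cast
      rw [Int.mul_ediv_cancel_left _ he']
      push_cast
      field_simp
    have h2 : ((∑ i, φ (e i) - 2 * N : ℤ) : ℚ) ≤ 0 := by
      push_cast
      simp only [h1, ← Finset.mul_sum]
      have : (0 : ℚ) < N := by exact_mod_cast hNpos
      nlinarith
    exact_mod_cast h2
  have hord : ∀ τ : ℍ, ∃ n : ℤ, n ≤ 0 ∧ meromorphicOrderAt f τ = n := by
    intro τ
    refine ⟨_, ?_, meromorphicOrderAt_baseForm ht p N _ τ⟩
    rw [sum_fibre_eq ht hell φ (by simp [hφ])]
    have h1 : (stabilizerOrder Γ τ : ℤ) * φ (stabilizerOrder Γ τ) =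
        N * ((stabilizerOrder Γ τ : ℤ) - 1) := by
      have : (stabilizerOrder Γ τ : ℤ) * ((N : ℤ) / (stabilizerOrder Γ τ : ℤ)) = N :=
        Int.mul_ediv_cancel' (by exact_mod_cast hdvd' τ)
      simp only [hφ, mul_sub, this]
      ring
    rw [h1, sub_self, zero_add]
    split_ifs
    · exact mul_nonpos_of_nonneg_of_nonpos (by positivity) hsum
    · exact le_rfl
  obtain ⟨g, hg, hgf, -⟩ := exists_holomorphic_extension (f := f⁻¹)
    (fun τ => (meromorphicAt_baseForm ht p N _ τ).inv) (fun τ => by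
      obtain ⟨n, hn, hn'⟩ := hord τ
      rw [meromorphicOrderAt_inv, hn']
      exact_mod_cast neg_nonneg.2 hn)
  have hg0 := eq_zero_of_weight_neg Γ hNpos.ne' hg fun γ hγ z => by
    have hj := pow_ne_zero (2 * N) (autFactor_ne_zero γ z)
    have := extension_smul ht hg.continuous hgf (γ := γ)
      (j := fun z => (autFactor γ z ^ (2 * N))⁻¹)
      (((continuous_autFactor γ).pow _).inv₀ fun z => pow_ne_zero _ (autFactor_ne_zero γ z))
      (fun z hz => by
        simp only [Pi.inv_apply, hf]
        rw [baseForm_smul ht p N _ hγ hz, mul_inv]) z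
    rw [this]
    field_simp
  obtain ⟨n, -, hn⟩ := hord I
  have hne := eventually_nhdsNE_coe.1 ((meromorphicOrderAt_ne_top_iff_eventually_ne_zero
    (meromorphicAt_baseForm ht p N _ I)).1 (by rw [← hf, hn]; exact WithTop.coe_ne_top))
  obtain ⟨z, hz, hz'⟩ := (hne.and (hgf I)).exists
  rw [hg0, Pi.inv_apply, eq_comm, inv_eq_zero] at hz'
  exact hz hz'

end

/-! ### The basis of the space of automorphic forms -/

/-- `⌊m (1 - 1 / n)⌋`. -/
def floorExponent (m n : ℕ) : ℤ := ⌊(m : ℚ) * (1 - 1 / (n : ℚ))⌋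

lemma floorExponent_one (m : ℕ) : floorExponent m 1 = 0 := by simp [floorExponent]

lemma mul_floorExponent_le (m : ℕ) {n : ℕ} (hn : n ≠ 0) :
    (n : ℤ) * floorExponent m n ≤ m * ((n : ℤ) - 1) := by
  have h0 : (0 : ℚ) < n := by exact_mod_cast Nat.pos_of_ne_zero hn
  have h1 : (floorExponent m n : ℚ) ≤ m * (1 - 1 / (n : ℚ)) := Int.floor_le _
  have h2 : (n : ℚ) * floorExponent m n ≤ m * ((n : ℚ) - 1) := by
    calc (n : ℚ) * floorExponent m n ≤ n * (m * (1 - 1 / (n : ℚ))) := by gcongr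
      _ = m * ((n : ℚ) - 1) := by field_simp
  exact_mod_cast h2

lemma lt_mul_floorExponent (m : ℕ) {n : ℕ} (hn : n ≠ 0) :
    m * ((n : ℤ) - 1) < n * floorExponent m n + n := by
  have h0 : (0 : ℚ) < n := by exact_mod_cast Nat.pos_of_ne_zero hn
  have h1 : m * (1 - 1 / (n : ℚ)) < floorExponent m n + 1 := Int.lt_floor_add_one _
  have h2 : m * ((n : ℚ) - 1) < n * floorExponent m n + n := by
    calc m * ((n : ℚ) - 1) = n * (m * (1 - 1 / (n : ℚ))) := by field_simp
      _ < n * (floorExponent m n + 1) := by gcongr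
      _ = n * floorExponent m n + n := by ring
  exact_mod_cast h2

/-- A strict inequality of integers gains one: `m(n-1) ≤ n⌊m(1-1/n)⌋ + (n-1)`. -/
lemma le_floorExponent (m : ℕ) {n : ℕ} (hn : n ≠ 0) :
    ((m : ℚ) - 1) * (1 - 1 / (n : ℚ)) ≤ floorExponent m n := by
  have h0 : (0 : ℚ) < n := by exact_mod_cast Nat.pos_of_ne_zero hn
  have h1 : ((m : ℤ) - 1) * ((n : ℤ) - 1) ≤ n * floorExponent m n := by
    have := lt_mul_floorExponent m hn
    linarith
  have h2 : ((m : ℚ) - 1) * ((n : ℚ) - 1) ≤ n * floorExponent m n := by exact_mod_cast h1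
  have h3 : ((m : ℚ) - 1) * (1 - 1 / (n : ℚ)) = ((m : ℚ) - 1) * ((n : ℚ) - 1) / n := by
    field_simp
  rw [h3, div_le_iff₀ h0]
  linarith

section

variable {Γ : Subgroup SL(2, ℝ)} {t : ℍ → OnePoint ℂ} (ht : IsUniformizer Γ t)
  [CompactSpace (MulAction.orbitRel.Quotient Γ ℍ)] [DecidableEq (OnePoint ℂ)]
  {r : ℕ} {p : Fin r → ℍ} {e : Fin r → ℕ} (hell : AreEllipticPoints Γ p e)

include ht hell

omit [DecidableEq (OnePoint ℂ)] in
/-- The dimension formula gives a nonnegative number. -/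
lemma neg_one_le_sum_floorExponent {m : ℕ} (hm : 2 ≤ m) :
    -1 ≤ ∑ i, floorExponent m (e i) - 2 * (m : ℤ) := by
  have h1 := two_lt_sum ht hell
  have h2 : ∑ i, ((m : ℚ) - 1) * (1 - 1 / (e i : ℚ)) ≤ ∑ i, (floorExponent m (e i) : ℚ) :=
    Finset.sum_le_sum fun i _ => le_floorExponent m (by have := hell.one_lt i; omega)
  rw [← Finset.mul_sum] at h2
  have h3 : (2 : ℚ) ≤ m := by exact_mod_cast hm
  have h4 : (-2 : ℚ) < ((∑ i, floorExponent m (e i) - 2 * (m : ℤ) : ℤ) : ℚ) := by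
    push_cast
    nlinarith
  have h5 : -2 < ∑ i, floorExponent m (e i) - 2 * (m : ℤ) := by exact_mod_cast h4
  omega

omit [CompactSpace (MulAction.orbitRel.Quotient Γ ℍ)] in
/-- The order of the form `t' ^ m * ∏ (t - a i) ^ (-⌊m (1 - 1 / e i)⌋)`. -/
lemma exists_order_baseForm_floorExponent (m : ℕ) (τ : ℍ) :
    ∃ R : ℤ, 0 ≤ R ∧ R < stabilizerOrder Γ τ ∧
      meromorphicOrderAt (baseForm t p m fun i => floorExponent m (e i)) τ =
        ((R + if t τ = OnePoint.infty then (stabilizerOrder Γ τ : ℤ) *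
          (∑ i, floorExponent m (e i) - 2 * m) else 0 : ℤ) : WithTop ℤ) := by
  have he := (analyticOrderAt_localParam ht τ).1
  have h1 := mul_floorExponent_le m he
  have h2 := lt_mul_floorExponent m he
  -- `R` is the remainder `m(e-1) - e⌊m(1-1/e)⌋`, lost by rounding down.
  refine ⟨_, sub_nonneg.2 h1, by linarith, ?_⟩
  rw [meromorphicOrderAt_baseForm ht, sum_fibre_eq ht hell _ (floorExponent_one m)]

omit [CompactSpace (MulAction.orbitRel.Quotient Γ ℍ)] in
/-- The functions of the basis extend to automorphic forms. -/
lemma exists_basis_form {m d : ℕ} (hd : (d : ℤ) = ∑ i, floorExponent m (e i) - 2 * m + 1)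
    (j : Fin d) :
    ∃ g ∈ automorphicForms Γ (2 * m),
      (∀ τ : ℍ, ∀ᶠ z : ℍ in 𝓝[≠] τ, g z =
        baseForm t p m (fun i => floorExponent m (e i)) z * finitePart t z ^ (j : ℕ)) ∧
      ∀ τ : ℍ, t τ ≠ OnePoint.infty → (∀ i, t τ ≠ t (p i)) → g τ =
        baseForm t p m (fun i => floorExponent m (e i)) τ * finitePart t τ ^ (j : ℕ) := by
  have hT := meromorphicAt_finitePart ht
  have hB := meromorphicAt_baseForm ht p m fun i => floorExponent m (e i)
  obtain ⟨g, hg, hgf, hga⟩ := exists_holomorphic_extension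
    (f := fun z => baseForm t p m (fun i => floorExponent m (e i)) z * finitePart t z ^ (j : ℕ))
    (fun τ => (hB τ).fun_mul ((hT τ).fun_pow _)) (fun τ => by
      obtain ⟨R, hR0, -, hR⟩ := exists_order_baseForm_floorExponent ht hell m τ
      rw [fun_meromorphicOrderAt_mul (hB τ) ((hT τ).fun_pow _), hR]
      split_ifs with h
      · rw [fun_meromorphicOrderAt_pow (hT τ), meromorphicOrderAt_of_infty ht h]
        have hj : (j : ℤ) + 1 ≤ d := by exact_mod_cast j.2
        have h1 : (0 : ℤ) ≤ R + stabilizerOrder Γ τ * (∑ i, floorExponent m (e i) - 2 * m) +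
            (j : ℕ) * -(stabilizerOrder Γ τ : ℤ) := by
          have h2 : (j : ℤ) ≤ ∑ i, floorExponent m (e i) - 2 * m := by linarith
          have h3 := mul_le_mul_of_nonneg_left h2
            (by positivity : (0 : ℤ) ≤ stabilizerOrder Γ τ)
          linarith
        exact_mod_cast h1
      · rw [add_zero]
        exact add_nonneg (by exact_mod_cast hR0) ((analyticAt_finitePart
          ht.automorphic.meromorphic h).fun_pow _).meromorphicOrderAt_nonneg)
  refine ⟨g, ⟨hg, fun γ hγ τ => ?_⟩, hgf, fun τ hτ hp => hga τ ?_⟩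
  · exact extension_smul ht (f := fun z => baseForm t p m (fun i => floorExponent m (e i)) z *
      finitePart t z ^ (j : ℕ)) hg.continuous hgf (j := fun z => autFactor γ z ^ (2 * m))
      ((continuous_autFactor γ).pow _)
      (fun z hz => by rw [baseForm_smul ht p m _ hγ hz, finitePart_smul ht hγ, mul_assoc]) τ
  · have ha := analyticAt_finitePart ht.automorphic.meromorphic hτ
    refine ((ha.deriv.fun_pow m).fun_mul (Finset.analyticAt_fun_prod _ fun i hi => ?_)).fun_mul
      (ha.fun_pow _)
    refine (ha.fun_sub analyticAt_const).fun_zpow ?_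
    rw [finitePart_coe, sub_ne_zero]
    exact fun h => hp i (sphereToComplex_injOn hτ (Finset.mem_filter.1 hi).2 h)

/-- Every automorphic form is a multiple of the base form by a polynomial in `t`. -/
lemma exists_eq_baseForm_mul_sum {m d : ℕ}
    (hd : (d : ℤ) = ∑ i, floorExponent m (e i) - 2 * m + 1) {f : ℍ → ℂ}
    (hf : f ∈ automorphicForms Γ (2 * m)) :
    ∃ a : Fin d → ℂ, ∀ τ : ℍ, ∀ᶠ z : ℍ in 𝓝[≠] τ,
      f z = baseForm t p m (fun i => floorExponent m (e i)) z *
        ∑ j, a j * finitePart t z ^ (j : ℕ) := by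
  set B := baseForm t p m (fun i => floorExponent m (e i)) with hBdef
  have hB : ∀ τ : ℍ, MeromorphicAt B τ := meromorphicAt_baseForm ht p m _
  have hfa : ∀ τ : ℍ, AnalyticAt ℂ (fun z => f (ofComplex z)) τ := fun τ =>
    (UpperHalfPlane.mdifferentiable_iff.1 hf.1).analyticAt
      (isOpen_upperHalfPlaneSet.mem_nhds τ.im_pos)
  have hFm : ∀ τ : ℍ, MeromorphicAt (fun z => f (ofComplex z) / B z) τ := fun τ =>
    (hfa τ).meromorphicAt.fun_div (hB τ)
  have hB0 : ∀ τ : ℍ, ∀ᶠ z in 𝓝[≠] (τ : ℂ), B z ≠ 0 := by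
    intro τ
    obtain ⟨R, -, -, hR⟩ := exists_order_baseForm_floorExponent ht hell m τ
    exact (meromorphicOrderAt_ne_top_iff_eventually_ne_zero (hB τ)).1
      (by rw [hR]; exact WithTop.coe_ne_top)
  have hinv : ∀ γ ∈ Γ, ∀ z : ℍ, t z ≠ OnePoint.infty →
      f (ofComplex ((γ • z : ℍ) : ℂ)) / B ((γ • z : ℍ) : ℂ) = f (ofComplex z) / B z := by
    intro γ hγ z hz
    have h1 : f (γ • z) = autFactor γ z ^ (2 * m) * f z := hf.2 γ hγ z
    rw [ofComplex_apply, ofComplex_apply, h1, hBdef, baseForm_smul ht p m _ hγ hz]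
    exact mul_div_mul_left _ _ (pow_ne_zero _ (autFactor_ne_zero γ z))
  have hord : ∀ (τ : ℍ) (S : ℤ), (S = if t τ = OnePoint.infty then (stabilizerOrder Γ τ : ℤ) *
      (∑ i, floorExponent m (e i) - 2 * m) else 0) →
      ((-S : ℤ) : WithTop ℤ) ≤ meromorphicOrderAt (fun z => f (ofComplex z) / B z) τ := by
    intro τ S hS
    by_cases htop : meromorphicOrderAt (fun z => f (ofComplex z) / B z) τ = ⊤
    · rw [htop]; exact le_top
    obtain ⟨N, hN⟩ := WithTop.ne_top_iff_exists.1 htop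
    obtain ⟨R, hR0, hRe, hR⟩ := exists_order_baseForm_floorExponent ht hell m τ
    rw [← hS] at hR
    have h1 : meromorphicOrderAt (fun z => f (ofComplex z) / B z * B z) τ =
        ((N + (R + S) : ℤ) : WithTop ℤ) := by
      rw [fun_meromorphicOrderAt_mul (hFm τ) (hB τ), hR, ← hN]
      rfl
    have h2 : meromorphicOrderAt (fun z => f (ofComplex z) / B z * B z) τ =
        meromorphicOrderAt (fun z => f (ofComplex z)) τ := by
      refine meromorphicOrderAt_congr ?_
      filter_upwards [hB0 τ] with z hz
      rw [div_mul_cancel₀ _ hz]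
    have h3 := (hfa τ).meromorphicOrderAt_nonneg
    rw [← h2, h1] at h3
    have h3 : 0 ≤ N + (R + S) := by exact_mod_cast h3
    obtain ⟨q, rfl⟩ := stabilizerOrder_dvd_order ht (hFm τ) hinv hN.symm
    rw [← hN]
    obtain ⟨s, rfl⟩ : (stabilizerOrder Γ τ : ℤ) ∣ S := by
      rw [hS]
      split_ifs
      · exact dvd_mul_right _ _
      · exact dvd_zero _
    -- Holomorphy of `f` gives `e(q + s) ≥ -R > -e`, and integrality of `q + s` turns this into `q +
    -- s ≥ 0`.
    refine WithTop.coe_le_coe.2 ?_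
    have h4 : (0 : ℤ) < stabilizerOrder Γ τ * (q + s + 1) := by linarith
    have h5 : 0 < q + s + 1 := pos_of_mul_pos_right h4 (by positivity)
    have h6 : (0 : ℤ) ≤ stabilizerOrder Γ τ * (q + s) := mul_nonneg (by positivity) (by omega)
    linarith
  obtain ⟨a, ha⟩ := exists_eq_sum_pow ht d hFm hinv
    (fun τ hτ => by simpa using hord τ 0 (by rw [if_neg hτ]))
    (fun τ hτ => hord τ _ (by rw [if_pos hτ, hd, add_sub_cancel_right]))
  refine ⟨a, fun τ => ?_⟩
  filter_upwards [ha τ, eventually_nhdsNE_coe.1 (hB0 τ)] with z hz hz'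
  rw [← hz, ofComplex_apply, mul_div_cancel₀ _ hz']

/-- The basis of the space of automorphic forms of weight `2m`. -/
theorem exists_basis {m d : ℕ} (hd : (d : ℤ) = ∑ i, floorExponent m (e i) - 2 * m + 1) :
    ∃ b : Module.Basis (Fin d) ℂ (automorphicForms Γ (2 * m)), ∀ (j : Fin d) (τ : ℍ),
      t τ ≠ OnePoint.infty → (∀ i, t τ ≠ t (p i)) → (b j : ℍ → ℂ) τ =
        baseForm t p m (fun i => floorExponent m (e i)) τ * finitePart t τ ^ (j : ℕ) := by
  choose g hg hgf hgv using exists_basis_form ht hell hd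
  set B := baseForm t p m (fun i => floorExponent m (e i)) with hBdef
  have hsum : ∀ (a : Fin d → ℂ) (τ : ℍ), ∀ᶠ z : ℍ in 𝓝[≠] τ,
      ∑ j, a j * g j z = B z * ∑ j, a j * finitePart t z ^ (j : ℕ) := by
    intro a τ
    filter_upwards [eventually_all.2 fun j => hgf j τ] with z hz
    rw [Finset.mul_sum]
    refine Finset.sum_congr rfl fun j _ => ?_
    rw [hz]
    ring
  have hcoe : ∀ (a : Fin d → ℂ) (z : ℍ),
      ((∑ j, a j • (⟨g j, hg j⟩ : automorphicForms Γ (2 * m)) : automorphicForms Γ (2 * m)) :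
        ℍ → ℂ) z = ∑ j, a j * g j z := by
    intro a z
    simp [Finset.sum_apply]
  have hli : LinearIndependent ℂ fun j => (⟨g j, hg j⟩ : automorphicForms Γ (2 * m)) := by
    rw [Fintype.linearIndependent_iff]
    intro a ha i
    -- A linear relation says `P(t) = 0` near `I`; if `P ≠ 0`, this confines `t` to finitely many
    -- values, each taken only at isolated points.
    set P : ℂ[X] := ∑ j : Fin d, Polynomial.monomial (j : ℕ) (a j) with hP
    have hB0 : ∀ᶠ z : ℍ in 𝓝[≠] I, B z ≠ 0 := by
      obtain ⟨R, -, -, hR⟩ := exists_order_baseForm_floorExponent ht hell m I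
      exact eventually_nhdsNE_coe.1 ((meromorphicOrderAt_ne_top_iff_eventually_ne_zero
        (meromorphicAt_baseForm ht p m _ I)).1 (by rw [hR]; exact WithTop.coe_ne_top))
    have hroot : ∀ᶠ z : ℍ in 𝓝[≠] I, P.eval (finitePart t z) = 0 := by
      filter_upwards [hsum a I, hB0] with z hz hz'
      rw [← hcoe, ha] at hz
      have h1 := (mul_eq_zero.1 hz.symm).resolve_left hz'
      rw [hP, Polynomial.eval_finsetSum, ← h1]
      simp
    have hP0 : P = 0 := by
      by_contra hP0
      have hne : ∀ᶠ z in 𝓝[≠] I, ∀ x ∈ P.roots.toFinset, t z ≠ (x : OnePoint ℂ) :=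
        (Filter.eventually_all_finset _).2 fun x _ => ht.eventually_ne _ I
      obtain ⟨z, ⟨hz1, hz2⟩, hz3⟩ :=
        ((hroot.and hne).and (ht.eventually_ne OnePoint.infty I)).exists
      refine hz2 (finitePart t z) (by simpa [hP0] using hz1) ?_
      rw [finitePart_coe, coe_sphereToComplex hz3]
    have := congrArg (fun Q => Polynomial.coeff Q (i : ℕ)) hP0
    simpa [hP, Polynomial.finsetSum_coeff, Polynomial.coeff_monomial, Fin.val_inj] using this
  have hspan : ⊤ ≤ Submodule.span ℂ (range fun j =>
      (⟨g j, hg j⟩ : automorphicForms Γ (2 * m))) := by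
    rintro ⟨f, hf⟩ -
    obtain ⟨a, ha⟩ := exists_eq_baseForm_mul_sum ht hell hd hf
    rw [Submodule.mem_span_range_iff_exists_fun]
    refine ⟨a, Subtype.ext (funext fun τ => ?_)⟩
    rw [hcoe]
    refine eq_of_eventually_eq_nhdsNE (f := fun τ => ∑ j, a j * g j τ) (g := f) ?_
      hf.1.continuous.continuousAt ?_
    · exact (continuous_finsetSum _ fun j _ =>
        continuous_const.mul (hg j).1.continuous).continuousAt
    · filter_upwards [ha τ, hsum a τ] with z hz hz'
      rw [hz, hz']
  refine ⟨Module.Basis.mk hli hspan, fun j τ hτ hp => ?_⟩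
  rw [Module.Basis.mk_apply]
  exact hgv j τ hτ hp

end

end ShimuraGenusZero

end

theorem theorem4
    {K : Type*} [Field K] [NumberField K] [NumberField.IsTotallyReal K]
    {B : Type*} [Ring B] [Algebra K B] [Algebra ℚ B]
    (hB : IsQuaternionAlgebra K B)
    (hsplit : SplitsAtExactlyOneInfinitePlace K B)
    (hBne : IsEmpty (B ≃+* Matrix (Fin 2) (Fin 2) ℚ))
    (ι : B →+* Matrix (Fin 2) (Fin 2) ℝ)
    (O : Subalgebra (𝓞 K) B) (hO : IsQuaternionOrder O)
    (Γ : Subgroup SL(2, ℝ)) (hdiscrete : DiscreteTopology Γ)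
    (hcomm : Subgroup.Commensurable Γ (normOneGroup ι O))
    (hgenus : HasGenusZero Γ)
    {r : ℕ} (p : Fin r → ℍ) (e : Fin r → ℕ) (hell : AreEllipticPoints Γ p e)
    [DecidableEq (OnePoint ℂ)] (t : ℍ → OnePoint ℂ) (ht : IsHauptmodul Γ t)
    (k : ℕ) (hk : Even k) (hk4 : 4 ≤ k) :
    ∃ d : ℕ,
      (d : ℤ) = 1 - (k : ℤ) + ∑ i, ⌊((k : ℚ) / 2) * (1 - 1 / (e i : ℚ))⌋ ∧
      Module.finrank ℂ (automorphicForms Γ k) = d ∧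
      ∃ b : Module.Basis (Fin d) ℂ (automorphicForms Γ k),
        ∀ (j : Fin d) (τ : ℍ), t τ ≠ OnePoint.infty → (∀ i, t τ ≠ t (p i)) →
          (b j : ℍ → ℂ) τ =
            deriv (finitePart t) (τ : ℂ) ^ (k / 2) * sphereToComplex (t τ) ^ (j : ℕ) *
              ∏ i with t (p i) ≠ OnePoint.infty,
                (sphereToComplex (t τ) - sphereToComplex (t (p i))) ^
                  (-⌊((k : ℚ) / 2) * (1 - 1 / (e i : ℚ))⌋) := by
  have hcompact : CompactSpace (MulAction.orbitRel.Quotient Γ ℍ) := by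
    obtain ⟨φ, -⟩ := hgenus
    exact φ.symm.compactSpace
  have hu := ShimuraGenusZero.isUniformizer_of_isHauptmodul ht hgenus
  obtain ⟨m, rfl⟩ := even_iff_exists_two_mul.1 hk
  have hfloor : ∀ i, ⌊(((2 * m : ℕ) : ℚ) / 2) * (1 - 1 / (e i : ℚ))⌋ =
      ShimuraGenusZero.floorExponent m (e i) := by
    intro i
    rw [ShimuraGenusZero.floorExponent]
    congr 2
    push_cast
    ring
  simp only [hfloor]
  -- Here `k ≥ 4` enters as `m ≥ 2`; nonnegativity of the dimension expression ensures that `toNat`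
  -- below does not truncate.
  have hnonneg := ShimuraGenusZero.neg_one_le_sum_floorExponent hu hell (m := m) (by omega)
  have hd : (((∑ i, ShimuraGenusZero.floorExponent m (e i) - 2 * (m : ℤ) + 1).toNat : ℕ) : ℤ) =
      ∑ i, ShimuraGenusZero.floorExponent m (e i) - 2 * m + 1 := Int.toNat_of_nonneg (by linarith)
  obtain ⟨b, hb⟩ := ShimuraGenusZero.exists_basis hu hell hd
  refine ⟨_, ?_, ?_, b, fun j τ hτ hp => ?_⟩
  · rw [hd]
    push_cast
    ring
  · rw [Module.finrank_eq_card_basis b, Fintype.card_fin]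
  · rw [hb j τ hτ hp, ShimuraGenusZero.baseForm, ShimuraGenusZero.finitePart_coe,
      Nat.mul_div_cancel_left m (by norm_num)]
    ring
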